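/- Let $\beta\le 1<\gamma$, $\beta\gamma>1$ and $0<\lambda<\lambda_0=\sqrt{\gamma/\beta}$. There is a constant $C_0=C_0(\beta,\gamma,\lambda)>0$ such that the following holds for every constant $C_D\ge C_0$. Let $G=(V,E)$ be a finite simple graph with $n=|V|\ge 3$ vertices, with edge activities $\beta_e,\gamma_e>0$ ($e\in E$) and external fields $\lambda_v>0$ ($v\in V$) forming a $(\beta,\gamma,\lambda)$-ferromagnetic two-spin system, i.e. $\lambda_v<\lambda$ for all $v\in V$ and $\beta_e\le\beta$, $\gamma\le\gamma_e$, $1<\beta_e\gamma_e\le\beta\gamma$ for all $e\in E$. Let $\mu$ be its Gibbs distribution on $\{0,1\}^V$, $$\mu(\sigma)\propto\prod_{v:\sigma_v=0}\lambda_v\prod_{e=\{u,w\}\in E:\ \sigma_u=\sigma_w=0}\beta_e\prod_{e=\{u,w\}\in E:\ \sigma_u=\sigma_w=1}\gamma_e .$$ Put $D_1=C_D\log\log n$ and $D_2=(\log n)^3$, and fix $v\in V$. The region $S_v$. Let $T$ be the self-avoiding walk tree of $G$ rooted at $v$: its nodes are the walks $v_0-v_1-\dots-v_\ell$ with $v_0=v$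 such that $v_0-\dots-v_{\ell-1}$ is self-avoiding and $v_\ell\ne v_{\ell-2}$; the node is a copy of $v_\ell$, and its parent is $v_0-\dots-v_{\ell-1}$. Let $T'$ be $T$ with all cycle-closing leaves (those with $v_\ell\in\{v_0,\dots,v_{\ell-1}\}$) removed. For a node $p$ of $T'$ let $\mathrm{cld}(p)$ be its set of children in $T'$ and let $\mathrm{degsum}(p)=\sum_w|\mathrm{cld}(w)|$ over all nodes $w$ on the path from the root to $p$, both included. Run a depth-first search in $T'$ from the root. A call at $p$ puts $p$ into $Q_v$. If $\mathrm{degsum}(p)<D_1$, it then calls the search at every child of $p$. If $\mathrm{degsum}(p)\ge D_1$, it makes no further calls, but if in addition $|\mathrm{cld}(p)|<D_2$, it puts all children of $p$ into $Q_v$. Let $S_v$ be the set of vertices of $G$ that have a copy in $Q_v$, and let $\partial S_v$ be the set of vertices outside $S_v$ with a neighbour in $S_v$. Good boundary conditions. Let $\Omega_{\partial S_v}$ be the set of $\sigma\in\{0,1\}^{\partial S_v}$ such that every $u\in S_v$ with $K>D_2/3$ neighbours in $\partial S_v$ has at least $K/\log n+2$ neighbours $w\in\partial S_v$ with $\sigma(w)=1$.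 Then $\Omega_{\partial S_v}\neq\emptyset$, and with $$a_u=\max_{\sigma\in\Omega_{\partial S_v}}d_{\mathrm{TV}}\bigl(\mu_v^{\sigma^{u\leftarrow 0}},\mu_v^{\sigma^{u\leftarrow 1}}\bigr)\qquad(u\in\partial S_v),$$ where $\sigma^{u\leftarrow c}$ is $\sigma$ with the value at $u$ changed to $c$ and $\mu_v^{\tau}$ is the marginal at $v$ of $\mu$ conditioned on the configuration $\tau$ on $\partial S_v$, we have $$\sum_{u\in\partial S_v}a_u\le\frac1{20}.$$ -/

import Mathlib

/-- A two-spin system on a simple graph: an edge activity pair `(β e, γ e)` for every edge and an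
external field `lam v` for every vertex, all positive. (Values off the edge set are never used.) -/
structure TwoSpinSystem (V : Type*) where
  graph : SimpleGraph V
  β : Sym2 V → ℝ
  γ : Sym2 V → ℝ
  lam : V → ℝ
  β_pos : ∀ e ∈ graph.edgeSet, 0 < β e
  γ_pos : ∀ e ∈ graph.edgeSet, 0 < γ e
  lam_pos : ∀ v, 0 < lam v

namespace TwoSpinSystem

variable {V : Type*}

/-- A two-spin system is ferromagnetic if `β_e γ_e ≥ 1` for all edges `e`. -/
def IsFerromagnetic (M : TwoSpinSystem V) : Prop :=
  ∀ e ∈ M.graph.edgeSet, 1 ≤ M.β e * M.γ e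

/-- `(β, γ, lam)`-ferromagnetic two-spin systems. -/
structure IsFerromagneticWith (M : TwoSpinSystem V) (β γ lam : ℝ) : Prop where
  ferromagnetic : M.IsFerromagnetic
  lam_lt : ∀ v, M.lam v < lam
  β_le : ∀ e ∈ M.graph.edgeSet, M.β e ≤ β
  le_γ : ∀ e ∈ M.graph.edgeSet, γ ≤ M.γ e
  one_lt_mul : ∀ e ∈ M.graph.edgeSet, 1 < M.β e * M.γ e
  mul_le : ∀ e ∈ M.graph.edgeSet, M.β e * M.γ e ≤ β * γ

open Classical in
/-- The weight of a configuration: the product of `lam v` over the vertices of spin `0`, of `β e`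
over the edges with both ends of spin `0` and of `γ e` over the edges with both ends of spin `1`. -/
noncomputable def weight [Fintype V] (M : TwoSpinSystem V) (σ : V → Fin 2) : ℝ :=
  (∏ v with σ v = 0, M.lam v) *
    (∏ e ∈ M.graph.edgeFinset with ∀ x ∈ e, σ x = 0, M.β e) *
    (∏ e ∈ M.graph.edgeFinset with ∀ x ∈ e, σ x = 1, M.γ e)

open Classical in
/-- The Gibbs distribution, as a probability mass function on `{0,1}^V`. -/
noncomputable def gibbs [Fintype V] (M : TwoSpinSystem V) (σ : V → Fin 2) : ℝ :=
  M.weight σ / ∑ τ, M.weight τ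

end TwoSpinSystem

section Marginals

variable {V : Type*} [Fintype V]

open Classical in
/-- The conditional marginal `c ↦ Pr_{X ∼ μ}[X v = c | X(B) = τ]` of a mass function `μ`. -/
noncomputable def condMarginal (μ : (V → Fin 2) → ℝ) (B : Finset V) (τ : B → Fin 2) (v : V)
    (c : Fin 2) : ℝ :=
  (∑ X with (∀ u : B, X u = τ u) ∧ X v = c, μ X) / ∑ X with ∀ u : B, X u = τ u, μ X

/-- Total variation distance of two mass functions on `{0,1}`. -/
noncomputable def tvDist (p q : Fin 2 → ℝ) : ℝ := (∑ c, |p c - q c|) / 2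

open Classical in
/-- The influence of the boundary vertex `u ∈ B` on `v`, maximised over the boundary conditions in
`Ω`: the maximum over `σ ∈ Ω` of the total variation distance between the marginals at `v` under the
boundary conditions `σ^{u ← 0}` and `σ^{u ← 1}`. -/
noncomputable def influence (μ : (V → Fin 2) → ℝ) (B : Finset V) (Ω : Set (B → Fin 2)) (v : V)
    (u : B) : ℝ :=
  ⨆ σ : Ω, tvDist (condMarginal μ B (Function.update σ.1 u 0) v)
    (condMarginal μ B (Function.update σ.1 u 1) v)

end Marginals

section Region

variable {V : Type*}

/-- The self-avoiding walk tree of `G` rooted at `v`. A node is a walk `v_0 - v_1 - ⋯ - v_ℓ` with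
`v_0 = v`, stored as the list `[v_ℓ, …, v_1, v_0]`, such that `v_0 - ⋯ - v_(ℓ-1)` is self-avoiding and
the last step does not go back (`v_ℓ ≠ v_(ℓ-2)`). The node is a copy of `v_ℓ`, and its parent is the
tail of the list. -/
def sawTree (G : SimpleGraph V) (v : V) : Set (List V) :=
  {q | q.getLast? = some v ∧ q.IsChain G.Adj ∧ q.tail.Nodup ∧ q.tail.tail.head? ≠ q.head?}

/-- A node is cycle-closing if its end vertex already occurs earlier on the walk. -/
def IsCycleClosing : List V → Prop
  | [] => False
  | u :: p => u ∈ p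

/-- The self-avoiding walk tree with all its cycle-closing nodes (which are leaves) removed. -/
def prunedSawTree (G : SimpleGraph V) (v : V) : Set (List V) :=
  {q | q ∈ sawTree G v ∧ ¬ IsCycleClosing q}

variable [Fintype V]

open Classical in
/-- The children of the node `p` in the pruned tree are the nodes `u :: p` with
`u ∈ prunedChildren G v p`. -/
noncomputable def prunedChildren (G : SimpleGraph V) (v : V) (p : List V) : Finset V :=
  {u | u :: p ∈ prunedSawTree G v}

/-- The sum of the numbers of children in the pruned tree over all nodes on the path from the root
to `p`, both included. -/
noncomputable def degsum (G : SimpleGraph V) (v : V) : List V → ℕ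
  | [] => 0
  | u :: p => (prunedChildren G v (u :: p)).card + degsum G v p

/-- The nodes of the pruned tree at which the depth-first search is called: it is called at the
root, and a call at `p` with `degsum p < D₁` makes calls at all children of `p`. -/
inductive DFSCalled (G : SimpleGraph V) (v : V) (D₁ : ℝ) : List V → Prop
  | root : DFSCalled G v D₁ [v]
  | step {p : List V} {u : V} : DFSCalled G v D₁ p → (degsum G v p : ℝ) < D₁ →
      u ∈ prunedChildren G v p → DFSCalled G v D₁ (u :: p)

/-- The set of nodes collected by the depth-first search: every node at which it is called and, when
a call at `p` with `degsum p ≥ D₁` finds fewer than `D₂` children of `p`, also these children. -/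
def dfsNodes (G : SimpleGraph V) (v : V) (D₁ D₂ : ℝ) : Set (List V) :=
  {q | DFSCalled G v D₁ q ∨
    ∃ p u, q = u :: p ∧ DFSCalled G v D₁ p ∧ D₁ ≤ (degsum G v p : ℝ) ∧
      ((prunedChildren G v p).card : ℝ) < D₂ ∧ u ∈ prunedChildren G v p}

open Classical in
/-- The region `S_v`: all vertices of `G` of which some copy is collected. -/
noncomputable def dfsRegion (G : SimpleGraph V) (v : V) (D₁ D₂ : ℝ) : Finset V :=
  {u | ∃ p, u :: p ∈ dfsNodes G v D₁ D₂}

open Classical in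
/-- The outer boundary `∂S`: the vertices outside `S` with a neighbour in `S`. -/
noncomputable def outerBoundary (G : SimpleGraph V) (S : Finset V) : Finset V :=
  {w | w ∉ S ∧ ∃ u ∈ S, G.Adj u w}

open Classical in
/-- The good boundary conditions on `∂S`: for every `u ∈ S` with more than `D₂ / 3` neighbours in
`∂S`, if `K` is their number, at least `K / log n + 2` of them have spin `1`, where `n = |V|`. -/
def goodBoundary (G : SimpleGraph V) (S : Finset V) (D₂ : ℝ) : Set (outerBoundary G S → Fin 2) :=
  {σ | ∀ u ∈ S, D₂ / 3 < (Finset.card {w : outerBoundary G S | G.Adj u w} : ℝ) →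
    (Finset.card {w : outerBoundary G S | G.Adj u w} : ℝ) / Real.log (Fintype.card V) + 2 ≤
      (Finset.card {w : outerBoundary G S | G.Adj u w ∧ σ w = 1} : ℝ)}

end Region

/-! Let x be the ratio of the probabilities of spins 0 and 1 at a vertex. Pinning a vertex to 0
multiplies the field of a neighbour by β_e, pinning it to 1 divides that field by γ_e. Exchanging
one effect for the other, neighbour by neighbour, gives x_v = f_v ∏ F(x_w) over the remaining
neighbours w, where x_w lives on the graph without v and with reduced fields
(`exists_marginalRatio_eq`). This takes the place of the self-avoiding walk tree. The reductions do
not depend on the fields, so two boundary conditions run through the same recursion.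

Use the potential t = log (lam / x). A vertex has t at least the sum of -log F over its children,
and each summand is at least δ = `decayRate` > 0. For subcritical fields the logarithmic slope g of
F satisfies g t ≤ -log F / 2 (`edgeSlope_mul_log_le`). Hence the sum of g_w t_w over the children of
v is at most t_v / 2, and the total influence below v is bounded linearly in t_v whatever the
degrees are (`influenceSum_le`).

The spare factor 2 pays for the stronger inequality g t exp (ε t) ≤ -log F
(`exists_edgeSlope_mul_exp_le`). A vertex with d children has t ≥ δ d, so carrying t exp (ε t) one
level up gains exp (-ε δ d), and along a path exp (-ε δ degsum) (`influenceSum_le_of_dfsCalled`).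
Where the search stops, t is large enough to supply what is missing: by the number of remaining
neighbours, or, if many neighbours lie in the boundary, by the spins 1 that a good boundary
condition puts there.

Stopping at degree sum of order log log n thus wins (log n)^4 against a loss of order (log n)^3 at
the leaves. At the root, passing from ratios to probabilities contributes exp (-t), which absorbs t
exp (ε t). For n below a constant, C₀ is so large that the search exhausts the component of v, and
the boundary is empty. -/

/-! ### Analysis of a single edge. -/

/-- The factor `(b x + 1) / (x + c)` by which a child of ratio `x` multiplies the ratio of its
parent across an edge with activities `(b, c)`. -/
noncomputable def edgeFactor (b c x : ℝ) : ℝ := (b * x + 1) / (x + c)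

/-- The logarithmic derivative `d log (edgeFactor b c x) / d log x`. -/
noncomputable def edgeSlope (b c x : ℝ) : ℝ := (b * c - 1) * x / ((b * x + 1) * (x + c))

section EdgeFactor

variable {b c x y z : ℝ}

lemma edgeFactor_pos (hb : 0 < b) (hc : 0 < c) (hx : 0 ≤ x) : 0 < edgeFactor b c x := by
  unfold edgeFactor; positivity

lemma edgeFactor_mono (hc : 0 < c) (hbc : 1 ≤ b * c) (hx : 0 ≤ x) (hxy : x ≤ y) :
    edgeFactor b c x ≤ edgeFactor b c y := by
  unfold edgeFactor
  rw [div_le_div_iff₀ (by positivity) (by linarith)]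
  nlinarith [mul_nonneg (sub_nonneg.2 hxy) (sub_nonneg.2 hbc)]

lemma edgeFactor_le_one (hb₁ : b ≤ 1) (hc : 1 ≤ c) (hx : 0 ≤ x) : edgeFactor b c x ≤ 1 := by
  unfold edgeFactor
  rw [div_le_one (by linarith)]
  nlinarith

lemma edgeSlope_nonneg (hb : 0 < b) (hc : 0 < c) (hbc : 1 ≤ b * c) (hx : 0 ≤ x) :
    0 ≤ edgeSlope b c x := by
  have := sub_nonneg.2 hbc
  unfold edgeSlope; positivity

lemma edgeSlope_le_one (hb : 0 < b) (hc : 0 < c) (hx : 0 ≤ x) : edgeSlope b c x ≤ 1 := by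
  unfold edgeSlope
  rw [div_le_one (by positivity)]
  nlinarith [mul_nonneg hb.le (mul_nonneg hx hx)]

lemma edgeSlope_le_mul (hb : 0 < b) (hc : 1 ≤ c) (hbc : 1 ≤ b * c) (hx : 0 ≤ x) :
    edgeSlope b c x ≤ (b * c - 1) * x := by
  unfold edgeSlope
  have := sub_nonneg.2 hbc
  apply div_le_self (by positivity)
  nlinarith [mul_nonneg hb.le hx, mul_nonneg (mul_nonneg hb.le hx) (add_nonneg hx (by linarith : 0 ≤ c))]

/-- The reciprocal of the slope is proportional to `b * x + c / x + b * c + 1`, which decreases up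
to `x = √(c / b)`. -/
lemma edgeSlope_mono (hb : 0 < b) (hc : 0 < c) (hbc : 1 ≤ b * c) (hx : 0 < x) (hxz : x ≤ z)
    (hz : b * z ^ 2 ≤ c) : edgeSlope b c x ≤ edgeSlope b c z := by
  have hz0 : 0 < z := hx.trans_le hxz
  unfold edgeSlope
  rw [div_le_div_iff₀ (by positivity) (by positivity)]
  have h1 : 0 ≤ (z - x) * (c - b * x * z) := by
    apply mul_nonneg (sub_nonneg.2 hxz)
    nlinarith [mul_nonneg hb.le (mul_nonneg hz0.le (sub_nonneg.2 hxz))]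
  nlinarith [mul_nonneg (sub_nonneg.2 hbc) h1]

lemma hasDerivAt_log_edgeFactor (hb : 0 < b) (hc : 0 < c) (hx : 0 < x) :
    HasDerivAt (fun x => Real.log (edgeFactor b c x)) (edgeSlope b c x / x) x := by
  have h1 : HasDerivAt (fun x => b * x + 1) b x := by
    simpa using ((hasDerivAt_id x).const_mul b).add_const 1
  have h2 : HasDerivAt (fun x => x + c) 1 x := (hasDerivAt_id x).add_const c
  have h3 := (h1.div h2 (by positivity)).log (edgeFactor_pos hb hc hx.le).ne'
  refine h3.congr_deriv ?_
  simp only [Pi.div_apply, edgeSlope]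
  field_simp
  ring

/-- Cauchy's mean value theorem against `Real.log`, that is, the mean value theorem in the variable
`log x`. -/
lemma exists_log_edgeFactor_sub (hb : 0 < b) (hc : 0 < c) (hy : 0 < y) (hyx : y < x) :
    ∃ ξ ∈ Set.Ioo y x, Real.log (edgeFactor b c x) - Real.log (edgeFactor b c y) =
      edgeSlope b c ξ * (Real.log x - Real.log y) := by
  have hpos : ∀ ξ ∈ Set.Icc y x, 0 < ξ := fun ξ hξ => hy.trans_le hξ.1
  obtain ⟨ξ, hξ, h⟩ := exists_ratio_hasDerivAt_eq_ratio_slope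
    (fun x => Real.log (edgeFactor b c x)) (fun ξ => edgeSlope b c ξ / ξ) hyx
    (fun ξ hξ => (hasDerivAt_log_edgeFactor hb hc (hpos ξ hξ)).continuousAt.continuousWithinAt)
    (fun ξ hξ => hasDerivAt_log_edgeFactor hb hc (hpos ξ ⟨hξ.1.le, hξ.2.le⟩))
    Real.log (fun ξ => ξ⁻¹)
    (fun ξ hξ => (Real.hasDerivAt_log (hpos ξ hξ).ne').continuousAt.continuousWithinAt)
    (fun ξ hξ => Real.hasDerivAt_log (hpos ξ ⟨hξ.1.le, hξ.2.le⟩).ne')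
  have hξ0 : 0 < ξ := hy.trans hξ.1
  refine ⟨ξ, hξ, ?_⟩
  field_simp at h
  linarith

lemma edgeSlope_mul_le_log_edgeFactor_sub (hb : 0 < b) (hc : 0 < c) (hbc : 1 ≤ b * c)
    (hy : 0 < y) (hyx : y ≤ x) (hx : b * x ^ 2 ≤ c) :
    edgeSlope b c y * (Real.log x - Real.log y) ≤
      Real.log (edgeFactor b c x) - Real.log (edgeFactor b c y) := by
  rcases hyx.eq_or_lt with rfl | hyx
  · simp
  obtain ⟨ξ, hξ, h⟩ := exists_log_edgeFactor_sub hb hc hy hyx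
  rw [h]
  have hξ0 : 0 < ξ := hy.trans hξ.1
  have h2 : b * ξ ^ 2 ≤ c := by
    refine le_trans ?_ hx
    gcongr
    exact hξ.2.le
  exact mul_le_mul_of_nonneg_right (edgeSlope_mono hb hc hbc hy hξ.1.le h2)
    (sub_nonneg.2 (Real.log_le_log hy hyx.le))

lemma abs_log_edgeFactor_sub_le (hb : 0 < b) (hc : 0 < c) (hbc : 1 ≤ b * c)
    (hx : 0 < x) (hy : 0 < y) (hxz : x ≤ z) (hyz : y ≤ z) (hz : b * z ^ 2 ≤ c) :
    |Real.log (edgeFactor b c x) - Real.log (edgeFactor b c y)| ≤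
      edgeSlope b c z * |Real.log x - Real.log y| := by
  wlog hyx : y ≤ x generalizing x y
  · rw [abs_sub_comm, abs_sub_comm (Real.log x)]
    exact this hy hx hyz hxz (le_of_not_ge hyx)
  rcases hyx.eq_or_lt with rfl | hyx
  · simp
  obtain ⟨ξ, hξ, h⟩ := exists_log_edgeFactor_sub hb hc hy hyx
  have hξ0 : 0 < ξ := hy.trans hξ.1
  rw [h, abs_mul, abs_of_nonneg (edgeSlope_nonneg hb hc hbc hξ0.le)]
  exact mul_le_mul_of_nonneg_right
    (edgeSlope_mono hb hc hbc hξ0 (hξ.2.le.trans hxz) hz) (abs_nonneg _)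

/-- The contraction estimate behind the potential `log (lam / x)`. -/
lemma edgeSlope_mul_log_le {lam : ℝ} (hb : 0 < b) (hb₁ : b ≤ 1) (hc : 1 < c) (hbc : 1 ≤ b * c)
    (hlam : b * lam ^ 2 ≤ c) (hx : 0 < x) (hxl : x ≤ lam) :
    edgeSlope b c x * Real.log (lam / x) ≤ -Real.log (edgeFactor b c x) / 2 := by
  have hc0 : 0 < c := by linarith
  have hl0 : 0 < lam := hx.trans_le hxl
  -- At `√(c / b)` the slope stops increasing and the edge factor equals `L⁻¹`. The mean value bound
  -- from `x` up to `L` therefore has the explicit right-hand side `-log L - log (edgeFactor b c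
  -- x)`.
  set L := Real.sqrt (c / b) with hL
  have hcb : 0 < c / b := by positivity
  have hL0 : 0 < L := Real.sqrt_pos.2 hcb
  have hL2 : L ^ 2 = c / b := Real.sq_sqrt hcb.le
  have hbL : b * L ^ 2 = c := by rw [hL2]; field_simp
  have hlL : lam ≤ L := by
    apply Real.le_sqrt_of_sq_le
    rw [le_div_iff₀ hb]; linarith
  have h1 := edgeSlope_mul_le_log_edgeFactor_sub hb hc0 hbc hx (hxl.trans hlL) hbL.le
  have h2 : edgeFactor b c L = L⁻¹ := by
    unfold edgeFactor
    rw [div_eq_iff (by positivity), inv_mul_eq_div, eq_div_iff hL0.ne']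
    linarith
  rw [h2, Real.log_inv] at h1
  have h3 : edgeSlope b c x * Real.log (lam / x) ≤
      edgeSlope b c x * (Real.log L - Real.log x) := by
    rw [Real.log_div hl0.ne' hx.ne']
    gcongr
    exact edgeSlope_nonneg hb hc0 hbc hx.le
  -- With `b ≤ 1` the term `-log L` is at most `-log c / 2`, which cancels half of `-log (edgeFactor
  -- b c x) ≤ log c`. This is the source of the factor 1/2.
  have h4 : Real.log c ≤ 2 * Real.log L := by
    rw [show (2 : ℝ) * Real.log L = Real.log (L ^ 2) by rw [Real.log_pow]; norm_num, hL2]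
    apply Real.log_le_log hc0
    rw [le_div_iff₀ hb]; nlinarith
  have h5 : -Real.log (edgeFactor b c x) ≤ Real.log c := by
    rw [← Real.log_inv]
    apply Real.log_le_log (inv_pos.2 (edgeFactor_pos hb hc0 hx.le))
    have : edgeFactor b c 0 ≤ edgeFactor b c x := edgeFactor_mono hc0 hbc le_rfl hx.le
    have h0 : edgeFactor b c 0 = c⁻¹ := by simp [edgeFactor]
    rw [h0] at this
    exact inv_le_of_inv_le₀ hc0 this
  linarith

end EdgeFactor

/-- A lower bound for `-log (edgeFactor b c x)` over `x ≤ lam` and all edges of the system. -/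
noncomputable def decayRate (β γ lam : ℝ) : ℝ := Real.log ((lam + γ) / (β * lam + 1))

lemma decayRate_pos {β γ lam : ℝ} (hβ : 0 < β) (hβ₁ : β ≤ 1) (hγ : 1 < γ) (hlam : 0 < lam) :
    0 < decayRate β γ lam := by
  apply Real.log_pos
  rw [one_lt_div (by positivity)]
  nlinarith

lemma decayRate_le {β γ lam b c x : ℝ} (hβ : 0 < β) (hγ : 0 < γ) (hβγ : 1 ≤ β * γ)
    (hb : 0 < b) (hbβ : b ≤ β) (hcγ : γ ≤ c) (hx : 0 < x) (hxl : x ≤ lam) :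
    decayRate β γ lam ≤ -Real.log (edgeFactor b c x) := by
  have hl : 0 < lam := hx.trans_le hxl
  have hc : 0 < c := by linarith
  rw [decayRate, ← Real.log_inv]
  apply Real.log_le_log (by positivity)
  have h1 := edgeFactor_mono hγ hβγ hx.le hxl
  have h2 : edgeFactor b c x ≤ edgeFactor β γ x := by
    unfold edgeFactor; gcongr
  have h3 := inv_anti₀ (edgeFactor_pos hb hc hx.le) (h2.trans h1)
  rwa [edgeFactor, inv_div] at h3

/-- The contraction estimate survives an additional factor `exp (ε t)`, where `t = log (lam / x)`,
for an `ε` which is uniform over all edges. -/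
lemma exists_edgeSlope_mul_exp_le {β γ lam : ℝ} (hβ : 0 < β) (hβ₁ : β ≤ 1) (hγ : 1 < γ)
    (hβγ : 1 < β * γ) (hlam : 0 < lam) (hlam₂ : β * lam ^ 2 ≤ γ) :
    ∃ ε : ℝ, 0 < ε ∧ ε ≤ 1 / 2 ∧ ∀ b c t : ℝ, 0 < b → b ≤ β → γ ≤ c → 1 ≤ b * c →
      b * c ≤ β * γ → 0 ≤ t →
      edgeSlope b c (lam * Real.exp (-t)) * (t * Real.exp (ε * t)) ≤
        -Real.log (edgeFactor b c (lam * Real.exp (-t))) := by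
  set δ := decayRate β γ lam with hδ
  have hδ0 : 0 < δ := decayRate_pos hβ hβ₁ hγ hlam
  set C := (β * γ - 1) * lam with hC
  have hC0 : 0 < C := mul_pos (by linarith) hlam
  -- Beyond `T` the exponentially small slope alone suffices: the left side is at most `C * (8 /
  -- t)`, hence at most `δ`.
  set T := 8 * C / δ with hT
  have hT0 : 0 < T := by positivity
  have hl2 : 0 < Real.log 2 := Real.log_pos one_lt_two
  -- The bound `log 2 / T` keeps `exp (ε t) ≤ 2` for `t ≤ T`, where the spare factor 2 absorbs it;
  -- the bound `1 / 2` leaves `exp (-t / 2)` for the tail.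
  refine ⟨min (1 / 2) (Real.log 2 / T), by positivity, min_le_left _ _, ?_⟩
  intro b c t hb hbβ hcγ hbc hbc' ht
  set ε := min (1 / 2) (Real.log 2 / T)
  have hε2 : ε ≤ 1 / 2 := min_le_left _ _
  have hεT : ε ≤ Real.log 2 / T := min_le_right _ _
  have hε0 : 0 < ε := by positivity
  have hx : 0 < lam * Real.exp (-t) := by positivity
  have hxl : lam * Real.exp (-t) ≤ lam := by
    have : Real.exp (-t) ≤ 1 := Real.exp_le_one_iff.2 (by linarith)
    nlinarith
  have hc1 : 1 < c := by linarith
  have hs0 := edgeSlope_nonneg hb (by linarith : 0 < c) hbc hx.le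
  by_cases htT : t ≤ T
  · have h1 : edgeSlope b c (lam * Real.exp (-t)) * Real.log (lam / (lam * Real.exp (-t))) ≤
        -Real.log (edgeFactor b c (lam * Real.exp (-t))) / 2 := by
      apply edgeSlope_mul_log_le hb (by linarith) hc1 hbc _ hx hxl
      nlinarith [sq_nonneg lam]
    have h2 : Real.log (lam / (lam * Real.exp (-t))) = t := by
      rw [Real.exp_neg]; field_simp; simp
    rw [h2] at h1
    have h3 : Real.exp (ε * t) ≤ 2 := by
      rw [← Real.exp_log two_pos]
      apply Real.exp_le_exp.2
      rw [le_div_iff₀ hT0] at hεT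
      nlinarith
    calc _ ≤ edgeSlope b c (lam * Real.exp (-t)) * (t * 2) := by gcongr
      _ ≤ _ := by linarith
  · push Not at htT
    have ht0 : 0 < t := hT0.trans htT
    refine le_trans ?_ (decayRate_le hβ (by linarith) hβγ.le hb hbβ hcγ hx hxl)
    have h1 := edgeSlope_le_mul hb hc1.le hbc hx.le
    have h2 : (b * c - 1) * (lam * Real.exp (-t)) ≤ C * Real.exp (-t) := by
      rw [hC, mul_assoc]; gcongr
    have h3 : Real.exp (-t) * (t * Real.exp (ε * t)) ≤ 8 / t := by
      have h4 : Real.exp (ε * t) ≤ Real.exp (t / 2) := Real.exp_le_exp.2 (by nlinarith)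
      have h5 : (t / 2) ^ 2 / 2 ≤ Real.exp (t / 2) := by
        have := Real.quadratic_le_exp_of_nonneg (show 0 ≤ t / 2 by linarith)
        linarith
      have h6 : Real.exp (-t) = (Real.exp (t / 2) * Real.exp (t / 2))⁻¹ := by
        rw [← Real.exp_add, ← Real.exp_neg]; ring_nf
      have h7 := Real.exp_pos (t / 2)
      calc Real.exp (-t) * (t * Real.exp (ε * t)) ≤ Real.exp (-t) * (t * Real.exp (t / 2)) := by
            gcongr
        _ = t / Real.exp (t / 2) := by rw [h6]; field_simp
        _ ≤ t / ((t / 2) ^ 2 / 2) := by gcongr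
        _ = 8 / t := by field_simp; norm_num
    calc _ ≤ C * Real.exp (-t) * (t * Real.exp (ε * t)) := by
          gcongr; exact h1.trans h2
      _ = C * (Real.exp (-t) * (t * Real.exp (ε * t))) := by ring
      _ ≤ C * (8 / t) := by gcongr
      _ ≤ C * (8 / T) := by gcongr
      _ = δ := by rw [hT]; field_simp

/-! ### Partition functions with variable fields and the recursion for marginal ratios. -/

namespace TwoSpinSystem

open Classical

variable {V : Type*}

/-- The factor by which pinning `v` to `0` changes the field at `w`. -/
noncomputable def zeroMul (M : TwoSpinSystem V) (v w : V) : ℝ :=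
  if M.graph.Adj v w then M.β s(v, w) else 1

/-- The inverse of the factor by which pinning `v` to `1` changes the field at `w`. -/
noncomputable def oneMul (M : TwoSpinSystem V) (v w : V) : ℝ :=
  if M.graph.Adj v w then M.γ s(v, w) else 1

lemma zeroMul_pos (M : TwoSpinSystem V) (v w : V) : 0 < M.zeroMul v w := by
  unfold zeroMul
  split_ifs with h
  · exact M.β_pos _ h
  · exact one_pos

lemma oneMul_pos (M : TwoSpinSystem V) (v w : V) : 0 < M.oneMul v w := by
  unfold oneMul
  split_ifs with h
  · exact M.γ_pos _ h
  · exact one_pos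

variable [Fintype V]

lemma prod_edges_insert (G : SimpleGraph V) (b : Sym2 V → ℝ) {v : V} {Y : Finset V} (hv : v ∉ Y) :
    ∏ e ∈ G.edgeFinset with ∀ x ∈ e, x ∈ insert v Y, b e =
      (∏ e ∈ G.edgeFinset with ∀ x ∈ e, x ∈ Y, b e) *
        ∏ w ∈ Y, if G.Adj v w then b s(v, w) else 1 := by
  rw [← Finset.prod_filter, ← Finset.prod_filter_mul_prod_filter_not
    (s := {e ∈ G.edgeFinset | ∀ x ∈ e, x ∈ insert v Y}) (p := fun e => v ∉ e)]
  congr 1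
  · apply Finset.prod_congr _ fun _ _ => rfl
    ext e
    simp only [Finset.mem_filter, Finset.mem_insert]
    constructor
    · rintro ⟨⟨h1, h2⟩, h3⟩
      refine ⟨h1, fun x hx => (h2 x hx).resolve_left ?_⟩
      rintro rfl
      exact h3 hx
    · rintro ⟨h1, h2⟩
      exact ⟨⟨h1, fun x hx => Or.inr (h2 x hx)⟩, fun h => hv (h2 v h)⟩
  · symm
    apply Finset.prod_bij (fun w _ => s(v, w))
    · intro w hw
      simp only [Finset.mem_filter] at hw
      simp only [Finset.mem_filter, SimpleGraph.mem_edgeFinset, SimpleGraph.mem_edgeSet,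
        Sym2.mem_iff, Finset.mem_insert]
      refine ⟨⟨hw.2, ?_⟩, by simp⟩
      rintro x (rfl | rfl)
      · exact Or.inl rfl
      · exact Or.inr hw.1
    · intro w₁ _ w₂ _ h
      exact Sym2.congr_right.1 h
    · intro e he
      simp only [Finset.mem_filter, not_not, SimpleGraph.mem_edgeFinset] at he
      obtain ⟨⟨h1, h2⟩, h3⟩ := he
      obtain ⟨w, rfl⟩ := Sym2.mem_iff_exists.1 h3
      rw [SimpleGraph.mem_edgeSet] at h1
      refine ⟨w, ?_, rfl⟩
      rw [Finset.mem_filter]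
      refine ⟨?_, h1⟩
      have := h2 w (by simp)
      rw [Finset.mem_insert] at this
      exact this.resolve_left h1.ne'
    · intros; rfl

/-- The weight of the configuration on `A` with fields `f` whose set of vertices of spin `0`
is `X ⊆ A`. -/
noncomputable def restrictedWeight (M : TwoSpinSystem V) (A : Finset V) (f : V → ℝ)
    (X : Finset V) : ℝ :=
  (∏ s ∈ X, f s) * (∏ e ∈ M.graph.edgeFinset with ∀ x ∈ e, x ∈ X, M.β e) *
    (∏ e ∈ M.graph.edgeFinset with ∀ x ∈ e, x ∈ A \ X, M.γ e)

/-- The partition function of the system induced on `A` with fields `f`. -/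
noncomputable def partSum (M : TwoSpinSystem V) (A : Finset V) (f : V → ℝ) : ℝ :=
  ∑ X ∈ A.powerset, M.restrictedWeight A f X

/-- The part of `partSum` with `v` of spin `0`. -/
noncomputable def partSumZero (M : TwoSpinSystem V) (A : Finset V) (f : V → ℝ) (v : V) : ℝ :=
  ∑ X ∈ (A.erase v).powerset, M.restrictedWeight A f (insert v X)

/-- The part of `partSum` with `v` of spin `1`. -/
noncomputable def partSumOne (M : TwoSpinSystem V) (A : Finset V) (f : V → ℝ) (v : V) : ℝ :=
  ∑ X ∈ (A.erase v).powerset, M.restrictedWeight A f X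

/-- The marginal ratio at `v` of the system induced on `A` with fields `f`. -/
noncomputable def marginalRatio (M : TwoSpinSystem V) (A : Finset V) (f : V → ℝ) (v : V) : ℝ :=
  M.partSumZero A f v / M.partSumOne A f v

variable (M : TwoSpinSystem V) {A : Finset V} {f : V → ℝ} {v : V}

lemma restrictedWeight_pos (hf : ∀ s, 0 < f s) (X : Finset V) :
    0 < M.restrictedWeight A f X := by
  unfold restrictedWeight
  refine mul_pos (mul_pos (Finset.prod_pos fun s _ => hf s) (Finset.prod_pos fun e he => ?_))
    (Finset.prod_pos fun e he => ?_)
  · exact M.β_pos e (SimpleGraph.mem_edgeFinset.1 (Finset.mem_filter.1 he).1)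
  · exact M.γ_pos e (SimpleGraph.mem_edgeFinset.1 (Finset.mem_filter.1 he).1)

lemma partSum_pos (hf : ∀ s, 0 < f s) : 0 < M.partSum A f :=
  Finset.sum_pos (fun X _ => M.restrictedWeight_pos hf X) ⟨∅, by simp⟩

lemma partSumZero_pos (hf : ∀ s, 0 < f s) : 0 < M.partSumZero A f v :=
  Finset.sum_pos (fun X _ => M.restrictedWeight_pos hf _) ⟨∅, by simp⟩

lemma partSumOne_pos (hf : ∀ s, 0 < f s) : 0 < M.partSumOne A f v :=
  Finset.sum_pos (fun X _ => M.restrictedWeight_pos hf X) ⟨∅, by simp⟩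

lemma marginalRatio_pos (hf : ∀ s, 0 < f s) : 0 < M.marginalRatio A f v :=
  div_pos (M.partSumZero_pos hf) (M.partSumOne_pos hf)

lemma partSum_eq_add (hv : v ∈ A) :
    M.partSum A f = M.partSumZero A f v + M.partSumOne A f v := by
  unfold partSum partSumZero partSumOne
  conv_lhs => rw [← Finset.insert_erase hv]
  rw [Finset.sum_powerset_insert (Finset.notMem_erase v A), add_comm, Finset.insert_erase hv]

/-- Pinning `v` to `0`. -/
lemma restrictedWeight_insert {X : Finset V} (hX : X ⊆ A.erase v) :
    M.restrictedWeight A f (insert v X) =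
      f v * M.restrictedWeight (A.erase v) (fun s => f s * M.zeroMul v s) X := by
  have hvX : v ∉ X := fun h => Finset.notMem_erase v A (hX h)
  have h1 : A \ insert v X = A.erase v \ X := by
    ext x; simp; tauto
  unfold restrictedWeight
  rw [prod_edges_insert _ _ hvX, Finset.prod_insert hvX, Finset.prod_mul_distrib, h1]
  simp only [zeroMul]
  ring

/-- Pinning `v` to `1`. -/
lemma restrictedWeight_erase (hv : v ∈ A) {X : Finset V} (hX : X ⊆ A.erase v) :
    M.restrictedWeight A f X = (∏ w ∈ A.erase v, M.oneMul v w) *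
      M.restrictedWeight (A.erase v) (fun s => f s * (M.oneMul v s)⁻¹) X := by
  have hvX : v ∉ A.erase v \ X := fun h => Finset.notMem_erase v A (Finset.mem_sdiff.1 h).1
  have h1 : A \ X = insert v (A.erase v \ X) := by
    ext x
    have : x = v → x ∉ X := by rintro rfl h; exact Finset.notMem_erase x A (hX h)
    simp only [Finset.mem_sdiff, Finset.mem_insert, Finset.mem_erase]
    by_cases hx : x = v
    · subst hx; simp [hv, this]
    · simp [hx]
  unfold restrictedWeight
  rw [h1, prod_edges_insert _ _ hvX, Finset.prod_mul_distrib, Finset.prod_inv_distrib,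
    ← Finset.prod_sdiff hX]
  have h2 : (∏ w ∈ X, M.oneMul v w) ≠ 0 := (Finset.prod_pos fun w _ => M.oneMul_pos v w).ne'
  simp only [oneMul] at h2 ⊢
  field_simp

lemma partSumZero_eq : M.partSumZero A f v =
    f v * M.partSum (A.erase v) (fun s => f s * M.zeroMul v s) := by
  unfold partSumZero partSum
  rw [Finset.mul_sum]
  exact Finset.sum_congr rfl fun X hX => M.restrictedWeight_insert (Finset.mem_powerset.1 hX)

lemma partSumOne_eq (hv : v ∈ A) : M.partSumOne A f v = (∏ w ∈ A.erase v, M.oneMul v w) *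
    M.partSum (A.erase v) (fun s => f s * (M.oneMul v s)⁻¹) := by
  unfold partSumOne partSum
  rw [Finset.mul_sum]
  exact Finset.sum_congr rfl fun X hX => M.restrictedWeight_erase hv (Finset.mem_powerset.1 hX)

lemma partSum_congr {f g : V → ℝ} (h : ∀ s ∈ A, f s = g s) : M.partSum A f = M.partSum A g := by
  refine Finset.sum_congr rfl fun X hX => ?_
  unfold restrictedWeight
  rw [Finset.prod_congr rfl fun s hs => h s (Finset.mem_powerset.1 hX hs)]

lemma partSum_update (hv : v ∈ A) (a : ℝ) :
    M.partSum A (Function.update f v (f v * a)) =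
      a * M.partSumZero A f v + M.partSumOne A f v := by
  have h : ∀ s ∈ A.erase v, Function.update f v (f v * a) s = f s := fun s hs =>
    Function.update_of_ne (Finset.ne_of_mem_erase hs) _ _
  rw [M.partSum_eq_add hv, M.partSumZero_eq, M.partSumOne_eq hv, M.partSumZero_eq,
    M.partSumOne_eq hv, Function.update_self,
    M.partSum_congr (f := fun s => Function.update f v (f v * a) s * M.zeroMul v s)
      (g := fun s => f s * M.zeroMul v s) (fun s hs => by rw [h s hs]),
    M.partSum_congr (f := fun s => Function.update f v (f v * a) s * (M.oneMul v s)⁻¹)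
      (g := fun s => f s * (M.oneMul v s)⁻¹) (fun s hs => by rw [h s hs])]
  ring

/-- The partition function is affine in the field at `v`, so the quotient of its values at two
fields depends only on the marginal ratio. The edge factor is this quotient up to `c`. -/
lemma partSum_update_eq (hv : v ∈ A) (hf : ∀ s, 0 < f s) {b c : ℝ} (hc : 0 < c) :
    M.partSum A (Function.update f v (f v * b)) =
      c * M.partSum A (Function.update f v (f v * c⁻¹)) *
        edgeFactor b c (M.marginalRatio A f v) := by
  rw [M.partSum_update hv, M.partSum_update hv]
  have h0 := M.partSumZero_pos (A := A) (v := v) hf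
  have h1 := M.partSumOne_pos (A := A) (v := v) hf
  unfold edgeFactor marginalRatio
  field_simp

/-- Changing the fields at the vertices of `N` one at a time. -/
lemma exists_partSum_telescope (N : Finset V) (hN : N ⊆ A) (b c : V → ℝ) (hb : ∀ w, 0 < b w)
    (hb₁ : ∀ w, b w ≤ 1) (hc : ∀ w, 1 ≤ c w) :
    ∃ m : V → V → ℝ, (∀ w s, 0 < m w s) ∧ (∀ w s, m w s ≤ 1) ∧ ∀ f : V → ℝ, (∀ s, 0 < f s) →
      M.partSum A (fun s => f s * if s ∈ N then b s else 1) =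
        (∏ w ∈ N, c w) * M.partSum A (fun s => f s * if s ∈ N then (c s)⁻¹ else 1) *
          ∏ w ∈ N, edgeFactor (b w) (c w) (M.marginalRatio A (fun s => f s * m w s) w) := by
  induction N using Finset.induction_on with
  | empty => exact ⟨fun _ _ => 1, by simp, by simp, by simp⟩
  | insert w N hw ih =>
    obtain ⟨m, hm0, hm1, hm⟩ := ih ((Finset.subset_insert _ _).trans hN)
    have hcw : 0 < c w := one_pos.trans_le (hc w)
    have hwA : w ∈ A := hN (Finset.mem_insert_self _ _)
    set κ : V → ℝ := fun s => if s = w then (c w)⁻¹ else 1 with hκ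
    have hκ0 : ∀ s, 0 < κ s := fun s => by simp only [hκ]; split_ifs <;> positivity
    have hκ1 : ∀ s, κ s ≤ 1 := fun s => by
      simp only [hκ]; split_ifs
      · exact inv_le_one_of_one_le₀ (hc w)
      · exact le_rfl
    set ν : V → ℝ := fun s => if s ∈ N then b s else 1 with hν
    have hν0 : ∀ s, 0 < ν s := fun s => by
      simp only [hν]; split_ifs
      · exact hb s
      · exact one_pos
    have hν1 : ∀ s, ν s ≤ 1 := fun s => by
      simp only [hν]; split_ifs
      · exact hb₁ s
      · exact le_rfl
    have hνw : ν w = 1 := by simp [hν, hw]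
    -- The new vertex `w` is switched first, while all of `N` still carries the factors `b`; the
    -- vertices of `N` are then switched with `w` already at `(c w)⁻¹`.
    refine ⟨fun w' s => if w' = w then ν s else κ s * m w' s, fun w' s => ?_, fun w' s => ?_,
      fun f hf => ?_⟩
    · dsimp only; split_ifs
      · exact hν0 s
      · exact mul_pos (hκ0 s) (hm0 w' s)
    · dsimp only; split_ifs
      · exact hν1 s
      · exact mul_le_one₀ (hκ1 s) (hm0 w' s).le (hm1 w' s)
    · have e1 : (fun s => f s * if s ∈ insert w N then b s else 1) =
          Function.update (fun s => f s * ν s) w (f w * ν w * b w) := by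
        ext s
        rcases eq_or_ne s w with rfl | hs
        · simp [hνw]
        · simp [hs, hν]
      have e2 : Function.update (fun s => f s * ν s) w (f w * ν w * (c w)⁻¹) =
          fun s => (f s * κ s) * if s ∈ N then b s else 1 := by
        ext s
        rcases eq_or_ne s w with rfl | hs
        · simp [hνw, hκ, hw]
        · simp [hs, hν, hκ]
      have e3 : (fun s => f s * if s ∈ insert w N then (c s)⁻¹ else 1) =
          fun s => (f s * κ s) * if s ∈ N then (c s)⁻¹ else 1 := by
        ext s
        rcases eq_or_ne s w with rfl | hs
        · simp [hκ, hw]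
        · simp [hs, hκ]
      rw [e1, M.partSum_update_eq (f := fun s => f s * ν s) hwA
        (fun s => mul_pos (hf s) (hν0 s)) hcw, e2, e3, hm _ fun s => mul_pos (hf s) (hκ0 s),
        Finset.prod_insert hw, Finset.prod_insert hw]
      dsimp only
      have e4 : ∏ x ∈ N, edgeFactor (b x) (c x) (M.marginalRatio A
            (fun s => f s * if x = w then ν s else κ s * m x s) x) =
          ∏ x ∈ N, edgeFactor (b x) (c x) (M.marginalRatio A (fun s => f s * κ s * m x s) x) := by
        refine Finset.prod_congr rfl fun x hx => ?_
        have hxw : x ≠ w := by rintro rfl; exact hw hx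
        simp only [hxw, if_false, mul_assoc]
      rw [e4]
      simp only [if_true]
      ring

/-- The tree recursion for marginal ratios. The ratios at the neighbours of `v` are taken with
fields that are reduced by factors which do not depend on the fields. -/
lemma exists_marginalRatio_eq (hβ₁ : ∀ e ∈ M.graph.edgeSet, M.β e ≤ 1)
    (hγ₁ : ∀ e ∈ M.graph.edgeSet, 1 ≤ M.γ e) (hv : v ∈ A) :
    ∃ m : V → V → ℝ, (∀ w s, 0 < m w s) ∧ (∀ w s, m w s ≤ 1) ∧ ∀ f : V → ℝ, (∀ s, 0 < f s) →
      M.marginalRatio A f v = f v * ∏ w ∈ A.erase v with M.graph.Adj v w,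
        edgeFactor (M.β s(v, w)) (M.γ s(v, w))
          (M.marginalRatio (A.erase v) (fun s => f s * m w s) w) := by
  obtain ⟨m, hm0, hm1, hm⟩ := M.exists_partSum_telescope
    (A := A.erase v) {w ∈ A.erase v | M.graph.Adj v w} (Finset.filter_subset _ _)
    (M.zeroMul v) (M.oneMul v) (M.zeroMul_pos v)
    (fun w => by unfold zeroMul; split_ifs with h; exacts [hβ₁ _ h, le_rfl])
    (fun w => by unfold oneMul; split_ifs with h; exacts [hγ₁ _ h, le_rfl])
  refine ⟨m, hm0, hm1, fun f hf => ?_⟩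
  have h0 : M.partSum (A.erase v) (fun s => f s * M.zeroMul v s) =
      M.partSum (A.erase v)
        (fun s => f s * if s ∈ {w ∈ A.erase v | M.graph.Adj v w} then M.zeroMul v s else 1) := by
    refine M.partSum_congr fun s hs => ?_
    by_cases h : M.graph.Adj v s
    · rw [if_pos (Finset.mem_filter.2 ⟨hs, h⟩)]
    · simp [h, zeroMul]
  have h1 : M.partSum (A.erase v) (fun s => f s * (M.oneMul v s)⁻¹) =
      M.partSum (A.erase v)
        (fun s => f s * if s ∈ {w ∈ A.erase v | M.graph.Adj v w} then (M.oneMul v s)⁻¹ else 1) := by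
    refine M.partSum_congr fun s hs => ?_
    by_cases h : M.graph.Adj v s
    · rw [if_pos (Finset.mem_filter.2 ⟨hs, h⟩)]
    · simp [h, oneMul]
  have h2 : ∏ w ∈ A.erase v, M.oneMul v w =
      ∏ w ∈ A.erase v with M.graph.Adj v w, M.oneMul v w := by
    rw [Finset.prod_filter]
    refine Finset.prod_congr rfl fun w _ => ?_
    by_cases h : M.graph.Adj v w <;> simp [h, oneMul]
  have h3 : ∏ w ∈ A.erase v with M.graph.Adj v w, edgeFactor (M.zeroMul v w) (M.oneMul v w)
        (M.marginalRatio (A.erase v) (fun s => f s * m w s) w) =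
      ∏ w ∈ A.erase v with M.graph.Adj v w, edgeFactor (M.β s(v, w)) (M.γ s(v, w))
        (M.marginalRatio (A.erase v) (fun s => f s * m w s) w) := by
    refine Finset.prod_congr rfl fun w hw => ?_
    have h := (Finset.mem_filter.1 hw).2
    simp [zeroMul, oneMul, h]
  rw [marginalRatio, M.partSumZero_eq, M.partSumOne_eq hv, h0, h1, h2, hm f hf, h3]
  have h4 : 0 < ∏ w ∈ A.erase v with M.graph.Adj v w, M.oneMul v w :=
    Finset.prod_pos fun w _ => M.oneMul_pos v w
  have h5 : 0 < M.partSum (A.erase v)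
      (fun s => f s * if s ∈ {w ∈ A.erase v | M.graph.Adj v w} then (M.oneMul v s)⁻¹ else 1) := by
    refine M.partSum_pos fun s => mul_pos (hf s) ?_
    split_ifs
    · exact inv_pos.2 (M.oneMul_pos v s)
    · exact one_pos
  generalize M.partSum (A.erase v)
    (fun s => f s * if s ∈ {w ∈ A.erase v | M.graph.Adj v w} then (M.oneMul v s)⁻¹ else 1) = P at h5 ⊢
  field_simp

end TwoSpinSystem

/-! ### Potentials and total influence in the truncated recursion. -/

/-- The conditions `0 < β ≤ 1 < γ`, `1 < β γ` and `0 < lam ≤ √(γ / β)` on the parameters. -/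
structure SubcriticalRegime (β γ lam : ℝ) : Prop where
  β_pos : 0 < β
  β_le_one : β ≤ 1
  one_lt_γ : 1 < γ
  one_lt_mul : 1 < β * γ
  lam_pos : 0 < lam
  mul_sq_le : β * lam ^ 2 ≤ γ

namespace TwoSpinSystem

open Classical

variable {V : Type*}

/-- The truncated recursion for an upper bound `lam * exp (-potential)` of the marginal ratio
at `v` of the system induced on `A`, if the field at `s` is at most `lam * exp (-k s)`. -/
noncomputable def potential (M : TwoSpinSystem V) (lam : ℝ) (k : V → ℝ) :
    ℕ → Finset V → V → ℝ
  | 0, _, v => k v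
  | n + 1, A, v => k v + ∑ w ∈ A.erase v with M.graph.Adj v w,
      -Real.log (edgeFactor (M.β s(v, w)) (M.γ s(v, w))
        (lam * Real.exp (-potential M lam k n (A.erase v) w)))

/-- The sum over self-avoiding walks in `A` from `v` of the product of the maximal slopes along the
walk, weighted with `K` at the end of the walk. -/
noncomputable def influenceSum (M : TwoSpinSystem V) (lam : ℝ) (k K : V → ℝ) :
    ℕ → Finset V → V → ℝ
  | 0, _, v => K v
  | n + 1, A, v => K v + ∑ w ∈ A.erase v with M.graph.Adj v w,
      edgeSlope (M.β s(v, w)) (M.γ s(v, w))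
        (lam * Real.exp (-potential M lam k n (A.erase v) w)) *
        influenceSum M lam k K n (A.erase v) w

/-- Linearity in the end weights lets the influences of all boundary vertices be added before any
estimate is made. -/
lemma influenceSum_sum {ι : Type*} (M : TwoSpinSystem V) (lam : ℝ) (k : V → ℝ) (I : Finset ι)
    (K : ι → V → ℝ) (n : ℕ) (A : Finset V) (v : V) :
    ∑ i ∈ I, M.influenceSum lam k (K i) n A v =
      M.influenceSum lam k (fun s => ∑ i ∈ I, K i s) n A v := by
  induction n generalizing A v with
  | zero => rfl
  | succ n ih =>
    simp only [influenceSum]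
    rw [Finset.sum_add_distrib, Finset.sum_comm]
    simp only [← Finset.mul_sum, ih]

lemma influenceSum_const_mul (M : TwoSpinSystem V) (lam : ℝ) (k K : V → ℝ) (a : ℝ) (n : ℕ)
    (A : Finset V) (v : V) :
    M.influenceSum lam k (fun s => a * K s) n A v = a * M.influenceSum lam k K n A v := by
  induction n generalizing A v with
  | zero => rfl
  | succ n ih =>
    simp only [influenceSum, ih, mul_add, Finset.mul_sum]
    congr 1
    refine Finset.sum_congr rfl fun w _ => by ring

variable {M : TwoSpinSystem V} {β γ lam : ℝ} {k K f f' : V → ℝ} {A S : Finset V} {v : V}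

section Edge

variable (hM : M.IsFerromagneticWith β γ lam) (hr : SubcriticalRegime β γ lam)
  {e : Sym2 V} (he : e ∈ M.graph.edgeSet)
include hM hr he

lemma edge_one_lt : 1 < M.γ e := hr.one_lt_γ.trans_le (hM.le_γ e he)

lemma edge_le_one : M.β e ≤ 1 := (hM.β_le e he).trans hr.β_le_one

lemma edge_mul_sq_le : M.β e * lam ^ 2 ≤ M.γ e :=
  (mul_le_mul_of_nonneg_right (hM.β_le e he) (sq_nonneg lam)).trans
    (hr.mul_sq_le.trans (hM.le_γ e he))

lemma neg_log_edgeFactor_nonneg {x : ℝ} (hx : 0 ≤ x) :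
    0 ≤ -Real.log (edgeFactor (M.β e) (M.γ e) x) := by
  have := edgeFactor_pos (M.β_pos e he) (M.γ_pos e he) hx
  have := edgeFactor_le_one (edge_le_one hM hr he) (edge_one_lt hM hr he).le hx
  linarith [Real.log_nonpos (by linarith) this]

end Edge

lemma lam_mul_exp_neg_le (hlam : 0 < lam) {t : ℝ} (ht : 0 ≤ t) : lam * Real.exp (-t) ≤ lam :=
  mul_le_of_le_one_right hlam.le (Real.exp_le_one_iff.2 (by linarith))

section

variable (hM : M.IsFerromagneticWith β γ lam) (hr : SubcriticalRegime β γ lam)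
include hM hr

lemma potential_nonneg (hk : ∀ s, 0 ≤ k s) (n : ℕ) : 0 ≤ M.potential lam k n A v := by
  cases n with
  | zero => exact hk v
  | succ n =>
    refine add_nonneg (hk v) (Finset.sum_nonneg fun w hw => ?_)
    have := hr.lam_pos
    exact neg_log_edgeFactor_nonneg hM hr (e := s(v, w)) (Finset.mem_filter.1 hw).2 (by positivity)

lemma le_potential (n : ℕ) : k v ≤ M.potential lam k n A v := by
  cases n with
  | zero => exact le_rfl
  | succ n =>
    refine le_add_of_nonneg_right (Finset.sum_nonneg fun w hw => ?_)
    have := hr.lam_pos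
    exact neg_log_edgeFactor_nonneg hM hr (e := s(v, w)) (Finset.mem_filter.1 hw).2 (by positivity)

/-- Each neighbour contributes at least `decayRate` to the potential. This turns degrees into decay.
-/
lemma decayRate_mul_card_le (hk : ∀ s, 0 ≤ k s) {n : ℕ} :
    decayRate β γ lam * (Finset.card {w ∈ A.erase v | M.graph.Adj v w} : ℝ) ≤
      M.potential lam k (n + 1) A v := by
  have hl := hr.lam_pos
  have h : ∀ w ∈ {w ∈ A.erase v | M.graph.Adj v w}, decayRate β γ lam ≤
      -Real.log (edgeFactor (M.β s(v, w)) (M.γ s(v, w))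
        (lam * Real.exp (-M.potential lam k n (A.erase v) w))) := by
    intro w hw
    have he : s(v, w) ∈ M.graph.edgeSet := (Finset.mem_filter.1 hw).2
    exact decayRate_le hr.β_pos (by linarith [hr.one_lt_γ]) hr.one_lt_mul.le (M.β_pos _ he)
      (hM.β_le _ he) (hM.le_γ _ he) (by positivity)
      (lam_mul_exp_neg_le hl (potential_nonneg hM hr hk n))
  have := Finset.card_nsmul_le_sum _ _ _ h
  rw [nsmul_eq_mul] at this
  simp only [potential]
  linarith [hk v]

lemma edgeSlope_mul_potential_le (hk : ∀ s, 0 ≤ k s) {w : V} (he : M.graph.Adj v w) (n : ℕ) :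
    edgeSlope (M.β s(v, w)) (M.γ s(v, w)) (lam * Real.exp (-M.potential lam k n A w)) *
        M.potential lam k n A w ≤
      -Real.log (edgeFactor (M.β s(v, w)) (M.γ s(v, w))
        (lam * Real.exp (-M.potential lam k n A w))) / 2 := by
  have hl := hr.lam_pos
  have he : s(v, w) ∈ M.graph.edgeSet := he
  have h := edgeSlope_mul_log_le (lam := lam) (M.β_pos _ he) (edge_le_one hM hr he)
    (edge_one_lt hM hr he) (hM.one_lt_mul _ he).le (edge_mul_sq_le hM hr he)
    (x := lam * Real.exp (-M.potential lam k n A w)) (by positivity)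
    (lam_mul_exp_neg_le hl (potential_nonneg hM hr hk n))
  have h2 : Real.log (lam / (lam * Real.exp (-M.potential lam k n A w))) =
      M.potential lam k n A w := by
    rw [Real.exp_neg]; field_simp; simp
  rwa [h2] at h

/-- A bound on the total influence in terms of the potential. -/
lemma influenceSum_le {m m' a : ℝ} (hk : ∀ s, 0 ≤ k s) (hm : 0 ≤ m)
    (ha : 2 * (m / decayRate β γ lam) + m' ≤ a)
    (hK : ∀ s, K s ≤ m + m' * k s) (hm' : 0 ≤ m') (n : ℕ) :
    M.influenceSum lam k K n A v ≤ K v + a * M.potential lam k n A v := by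
  have hδ : 0 < decayRate β γ lam :=
    decayRate_pos hr.β_pos hr.β_le_one hr.one_lt_γ hr.lam_pos
  have ha0 : 0 ≤ a := le_trans (by positivity) ha
  have hl := hr.lam_pos
  induction n generalizing A v with
  | zero =>
    have := potential_nonneg (A := A) (v := v) hM hr hk 0
    simp only [influenceSum]
    nlinarith
  | succ n ih =>
    have hc := decayRate_mul_card_le (A := A) (v := v) hM hr hk (n := n)
    rw [influenceSum]
    have h1 : ∀ w ∈ {w ∈ A.erase v | M.graph.Adj v w},
        edgeSlope (M.β s(v, w)) (M.γ s(v, w))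
          (lam * Real.exp (-potential M lam k n (A.erase v) w)) *
          influenceSum M lam k K n (A.erase v) w ≤ m + (m' + a) *
            (-Real.log (edgeFactor (M.β s(v, w)) (M.γ s(v, w))
              (lam * Real.exp (-M.potential lam k n (A.erase v) w))) / 2) := by
      intro w hw
      have he : s(v, w) ∈ M.graph.edgeSet := (Finset.mem_filter.1 hw).2
      have h2 := edgeSlope_mul_potential_le (A := A.erase v) hM hr hk
        (Finset.mem_filter.1 hw).2 n
      set g := edgeSlope (M.β s(v, w)) (M.γ s(v, w))
          (lam * Real.exp (-potential M lam k n (A.erase v) w))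
      have hg0 : 0 ≤ g := edgeSlope_nonneg (M.β_pos _ he) (M.γ_pos _ he)
        (hM.one_lt_mul _ he).le (by positivity)
      have hg1 : g ≤ 1 := edgeSlope_le_one (M.β_pos _ he) (M.γ_pos _ he) (by positivity)
      have hkt := le_potential (k := k) (A := A.erase v) (v := w) hM hr n
      calc _ ≤ g * (m + (m' + a) * M.potential lam k n (A.erase v) w) := by
            refine mul_le_mul_of_nonneg_left ((ih (A := A.erase v) (v := w)).trans ?_) hg0
            have := hK w
            nlinarith
        _ = g * m + (m' + a) * (g * M.potential lam k n (A.erase v) w) := by ring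
        _ ≤ _ := by
            refine add_le_add (mul_le_of_le_one_left hm hg1) ?_
            gcongr
    refine add_le_add le_rfl ((Finset.sum_le_sum h1).trans ?_)
    rw [Finset.sum_add_distrib, Finset.sum_const, nsmul_eq_mul, ← Finset.mul_sum,
      ← Finset.sum_div]
    have h3 : ∑ w ∈ A.erase v with M.graph.Adj v w,
        -Real.log (edgeFactor (M.β s(v, w)) (M.γ s(v, w))
              (lam * Real.exp (-M.potential lam k n (A.erase v) w))) ≤
        M.potential lam k (n + 1) A v := by
      rw [potential]; linarith [hk v]
    set t := M.potential lam k (n + 1) A v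
    have ht0 : 0 ≤ t := potential_nonneg hM hr hk (n + 1)
    have h4 : (Finset.card {w ∈ A.erase v | M.graph.Adj v w} : ℝ) * m ≤
        m / decayRate β γ lam * t := by
      rw [div_mul_eq_mul_div, le_div_iff₀ hδ]
      nlinarith
    -- The contraction returns only half of `a`, so the hypothesis `ha` is exactly what closes the
    -- induction.
    calc _ ≤ m / decayRate β γ lam * t + (m' + a) * (t / 2) := by gcongr
      _ = (2 * (m / decayRate β γ lam) + m' + a) / 2 * t := by ring
      _ ≤ (a + a) / 2 * t := by gcongr
      _ = a * t := by ring

variable [Fintype V]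

/-- Edge factors are increasing and at most 1, so truncating the recursion only weakens the upper
bound. The reduced fields still obey the field bound. -/
lemma marginalRatio_le (hv : v ∈ A) (hf : ∀ s, 0 < f s)
    (hfk : ∀ s, f s ≤ lam * Real.exp (-k s)) (n : ℕ) :
    M.marginalRatio A f v ≤ lam * Real.exp (-M.potential lam k n A v) := by
  have hβ₁ := fun e he => edge_le_one hM hr (e := e) he
  have hγ₁ := fun e he => (edge_one_lt hM hr (e := e) he).le
  induction n generalizing A v f with
  | zero =>
    obtain ⟨m, hm0, -, hm⟩ := M.exists_marginalRatio_eq hβ₁ hγ₁ hv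
    rw [hm f hf]
    refine (mul_le_of_le_one_right (hf v).le ?_).trans (hfk v)
    refine Finset.prod_le_one (fun w hw => ?_) fun w hw => ?_ <;>
      have he : s(v, w) ∈ M.graph.edgeSet := (Finset.mem_filter.1 hw).2 <;>
      have h0 := M.marginalRatio_pos (A := A.erase v) (v := w) fun s => mul_pos (hf s) (hm0 w s)
    · exact (edgeFactor_pos (M.β_pos _ he) (M.γ_pos _ he) h0.le).le
    · exact edgeFactor_le_one (hβ₁ _ he) (hγ₁ _ he) h0.le
  | succ n ih =>
    obtain ⟨m, hm0, hm1, hm⟩ := M.exists_marginalRatio_eq hβ₁ hγ₁ hv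
    rw [hm f hf, potential, neg_add, Real.exp_add, ← mul_assoc, ← Finset.sum_neg_distrib,
      Real.exp_sum]
    refine mul_le_mul (hfk v) ?_ (Finset.prod_nonneg fun w hw => ?_)
      ((hf v).le.trans (hfk v))
    · refine Finset.prod_le_prod (fun w hw => ?_) fun w hw => ?_ <;>
        have he : s(v, w) ∈ M.graph.edgeSet := (Finset.mem_filter.1 hw).2 <;>
        have h0 := M.marginalRatio_pos (A := A.erase v) (v := w) fun s => mul_pos (hf s) (hm0 w s)
      · exact (edgeFactor_pos (M.β_pos _ he) (M.γ_pos _ he) h0.le).le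
      · have hl := hr.lam_pos
        rw [neg_neg, Real.exp_log (edgeFactor_pos (M.β_pos _ he) (M.γ_pos _ he) (by positivity))]
        refine edgeFactor_mono (M.γ_pos _ he) (hM.one_lt_mul _ he).le h0.le ?_
        refine ih (Finset.mem_filter.1 hw).1 (fun s => mul_pos (hf s) (hm0 w s)) fun s => ?_
        exact (mul_le_of_le_one_right (hf s).le (hm1 w s)).trans (hfk s)
    · have he : s(v, w) ∈ M.graph.edgeSet := (Finset.mem_filter.1 hw).2
      have h0 := M.marginalRatio_pos (A := A.erase v) (v := w) fun s => mul_pos (hf s) (hm0 w s)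
      exact (edgeFactor_pos (M.β_pos _ he) (M.γ_pos _ he) h0.le).le

/-- The effect on the marginal ratio at `v ∈ S` of changing the fields, where `S` is a union of
connected components of the graph induced on `A`. -/
lemma abs_log_marginalRatio_sub_le (hk : ∀ s, 0 ≤ k s) (hv : v ∈ A) (hvS : v ∈ S)
    (hS : ∀ s ∈ S, ∀ w ∈ A, M.graph.Adj s w → w ∈ S) (hf : ∀ s, 0 < f s) (hf' : ∀ s, 0 < f' s)
    (hfk : ∀ s, f s ≤ lam * Real.exp (-k s)) (hfk' : ∀ s, f' s ≤ lam * Real.exp (-k s))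
    (hK : ∀ s ∈ S, |Real.log (f s) - Real.log (f' s)| ≤ K s) {n : ℕ} (hn : A.card ≤ n + 1) :
    |Real.log (M.marginalRatio A f v) - Real.log (M.marginalRatio A f' v)| ≤
      M.influenceSum lam k K n A v := by
  have hβ₁ := fun e he => edge_le_one hM hr (e := e) he
  have hγ₁ := fun e he => (edge_one_lt hM hr (e := e) he).le
  induction n generalizing A v f f' with
  | zero =>
    have hA : A.erase v = ∅ := by
      rw [← Finset.card_eq_zero, Finset.card_erase_of_mem hv]
      omega
    obtain ⟨m, hm0, -, hm⟩ := M.exists_marginalRatio_eq hβ₁ hγ₁ hv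
    rw [hm f hf, hm f' hf']
    simpa [hA, influenceSum] using hK v hvS
  | succ n ih =>
    obtain ⟨m, hm0, hm1, hm⟩ := M.exists_marginalRatio_eq hβ₁ hγ₁ hv
    have key : ∀ f : V → ℝ, (∀ s, 0 < f s) → Real.log (M.marginalRatio A f v) =
        Real.log (f v) + ∑ w ∈ A.erase v with M.graph.Adj v w,
          Real.log (edgeFactor (M.β s(v, w)) (M.γ s(v, w))
            (M.marginalRatio (A.erase v) (fun s => f s * m w s) w)) := by
      intro f hf
      have hpos : ∀ w ∈ {w ∈ A.erase v | M.graph.Adj v w},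
          edgeFactor (M.β s(v, w)) (M.γ s(v, w))
            (M.marginalRatio (A.erase v) (fun s => f s * m w s) w) ≠ 0 := by
        intro w hw
        have he : s(v, w) ∈ M.graph.edgeSet := (Finset.mem_filter.1 hw).2
        have h0 := M.marginalRatio_pos (A := A.erase v) (v := w) fun s => mul_pos (hf s) (hm0 w s)
        exact (edgeFactor_pos (M.β_pos _ he) (M.γ_pos _ he) h0.le).ne'
      rw [hm f hf, Real.log_mul (hf v).ne' (Finset.prod_ne_zero_iff.2 hpos), Real.log_prod hpos]
    rw [key f hf, key f' hf', add_sub_add_comm, ← Finset.sum_sub_distrib, influenceSum]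
    refine (abs_add_le _ _).trans (add_le_add (hK v hvS) ?_)
    refine (Finset.abs_sum_le_sum_abs _ _).trans (Finset.sum_le_sum fun w hw => ?_)
    have he : s(v, w) ∈ M.graph.edgeSet := (Finset.mem_filter.1 hw).2
    have hwA : w ∈ A.erase v := (Finset.mem_filter.1 hw).1
    have hl := hr.lam_pos
    have hg : ∀ f : V → ℝ, (∀ s, 0 < f s) → (∀ s, f s ≤ lam * Real.exp (-k s)) →
        (∀ s, 0 < f s * m w s) ∧ (∀ s, f s * m w s ≤ lam * Real.exp (-k s)) := fun f hf hfk =>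
      ⟨fun s => mul_pos (hf s) (hm0 w s),
        fun s => (mul_le_of_le_one_right (hf s).le (hm1 w s)).trans (hfk s)⟩
    obtain ⟨h1, h2⟩ := hg f hf hfk
    obtain ⟨h1', h2'⟩ := hg f' hf' hfk'
    have hz : M.β s(v, w) * (lam * Real.exp (-M.potential lam k n (A.erase v) w)) ^ 2 ≤
        M.γ s(v, w) := by
      refine le_trans ?_ (edge_mul_sq_le hM hr he)
      have := M.β_pos _ he
      have := lam_mul_exp_neg_le hl (potential_nonneg (A := A.erase v) (v := w) hM hr hk n)
      gcongr
    refine (abs_log_edgeFactor_sub_le (M.β_pos _ he) (M.γ_pos _ he) (hM.one_lt_mul _ he).le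
      (M.marginalRatio_pos h1) (M.marginalRatio_pos h1') (marginalRatio_le hM hr hwA h1 h2 n)
      (marginalRatio_le hM hr hwA h1' h2' n) hz).trans ?_
    refine mul_le_mul_of_nonneg_left ?_ (edgeSlope_nonneg (M.β_pos _ he) (M.γ_pos _ he)
      (hM.one_lt_mul _ he).le (by positivity))
    refine ih hwA (hS v hvS w (Finset.mem_of_mem_erase hwA) he)
      (fun s hs w hw => hS s hs w (Finset.mem_of_mem_erase hw)) h1 h1' h2 h2' (fun s hs => ?_) ?_
    -- The multipliers are the same for `f` and `f'`, so the logarithmic difference of the fields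
    -- does not change down the recursion.
    · rw [Real.log_mul (hf s).ne' (hm0 w s).ne', Real.log_mul (hf' s).ne' (hm0 w s).ne',
        add_sub_add_right_eq_sub]
      exact hK s hs
    · rw [Finset.card_erase_of_mem hv]
      omega

end

end TwoSpinSystem

/-! ### The depth-first search and its region. -/

section DFS

open Classical

variable {V : Type*} [Fintype V] {G : SimpleGraph V} {v u w : V} {p q : List V} {D₁ D₂ : ℝ}

lemma mem_prunedChildren (hp : u :: q ∈ prunedSawTree G v) :
    w ∈ prunedChildren G v (u :: q) ↔ G.Adj u w ∧ w ∉ u :: q := by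
  obtain ⟨⟨h1, h2, h3, -⟩, h5⟩ := hp
  have h5' : u ∉ q := h5
  simp only [prunedChildren, Finset.mem_filter, Finset.mem_univ, true_and]
  constructor
  · rintro ⟨⟨-, hc, -, -⟩, hw⟩
    exact ⟨(List.isChain_cons_cons.1 hc).1.symm, hw⟩
  · rintro ⟨h, hw⟩
    refine ⟨⟨?_, List.isChain_cons_cons.2 ⟨h.symm, h2⟩, List.nodup_cons.2 ⟨h5', h3⟩, ?_⟩, hw⟩
    · rw [List.getLast?_cons_cons, h1]
    · intro hh
      simp only [List.tail_cons, List.head?_cons] at hh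
      exact hw (List.mem_cons_of_mem _ (List.mem_of_mem_head? hh))

lemma DFSCalled.mem_prunedSawTree (h : DFSCalled G v D₁ p) : p ∈ prunedSawTree G v := by
  induction h with
  | root => simp [prunedSawTree, sawTree, IsCycleClosing]
  | step _ _ hu _ => simpa [prunedChildren] using hu

lemma DFSCalled.nodup (h : DFSCalled G v D₁ (u :: q)) : u ∉ q ∧ q.Nodup := by
  obtain ⟨⟨-, -, h3, -⟩, h5⟩ := h.mem_prunedSawTree
  exact ⟨h5, h3⟩

lemma DFSCalled.mem_dfsRegion (h : DFSCalled G v D₁ p) : ∀ x ∈ p, x ∈ dfsRegion G v D₁ D₂ := by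
  induction h with
  | root =>
    intro x hx
    rw [List.mem_singleton] at hx
    subst hx
    simp only [dfsRegion, Finset.mem_filter, Finset.mem_univ, true_and]
    exact ⟨[], Or.inl .root⟩
  | @step p u h h1 h2 ih =>
    intro x hx
    rcases List.mem_cons.1 hx with rfl | hx
    · simp only [dfsRegion, Finset.mem_filter, Finset.mem_univ, true_and]
      exact ⟨p, Or.inl (h.step h1 h2)⟩
    · exact ih x hx

lemma root_mem_dfsRegion : v ∈ dfsRegion G v D₁ D₂ :=
  DFSCalled.mem_dfsRegion (.root (D₁ := D₁)) v (List.mem_singleton_self v)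

/-- The children of a node at which the search is called lie in the region unless the node has
large degree and is a leaf of the search. -/
lemma DFSCalled.child_mem_dfsRegion (h : DFSCalled G v D₁ p)
    (hp : (degsum G v p : ℝ) < D₁ ∨ ((prunedChildren G v p).card : ℝ) < D₂)
    (hw : w ∈ prunedChildren G v p) : w ∈ dfsRegion G v D₁ D₂ := by
  by_cases h1 : (degsum G v p : ℝ) < D₁
  · exact (h.step h1 hw).mem_dfsRegion w List.mem_cons_self
  · simp only [dfsRegion, Finset.mem_filter, Finset.mem_univ, true_and]
    exact ⟨p, Or.inr ⟨p, w, rfl, h, not_lt.1 h1, hp.resolve_left h1, hw⟩⟩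

/-- The number of neighbours of `s ∈ S` in the boundary of `S`, and `0` for `s ∉ S`. -/
noncomputable def boundaryDegree (G : SimpleGraph V) (S : Finset V) (s : V) : ℝ :=
  if s ∈ S then (Finset.card {w ∈ outerBoundary G S | G.Adj s w} : ℝ) else 0

lemma boundaryDegree_nonneg (S : Finset V) (s : V) : 0 ≤ boundaryDegree G S s := by
  unfold boundaryDegree; split_ifs <;> positivity

lemma notMem_outerBoundary {S : Finset V} (h : w ∈ S) : w ∉ outerBoundary G S := by
  simp [outerBoundary, h]

lemma mem_of_notMem_outerBoundary {S : Finset V} (hs : u ∈ S) (h : w ∉ outerBoundary G S)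
    (hadj : G.Adj u w) : w ∈ S := by
  by_contra hw
  apply h
  simp only [outerBoundary, Finset.mem_filter, Finset.mem_univ, true_and]
  exact ⟨hw, u, hs, hadj⟩

/-- The children of a node of the search outside the boundary are its remaining neighbours. -/
lemma DFSCalled.card_children (h : DFSCalled G v D₁ (u :: q)) :
    ((prunedChildren G v (u :: q)).card : ℝ) =
      (Finset.card {w ∈ ((outerBoundary G (dfsRegion G v D₁ D₂))ᶜ \ q.toFinset).erase u |
        G.Adj u w} : ℝ) + boundaryDegree G (dfsRegion G v D₁ D₂) u := by
  set S := dfsRegion G v D₁ D₂ with hSdef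
  have hS := h.mem_dfsRegion (D₂ := D₂)
  rw [boundaryDegree, if_pos (hS u List.mem_cons_self), ← Nat.cast_add,
    ← Finset.card_filter_add_card_filter_not (s := prunedChildren G v (u :: q))
      (p := fun w => w ∉ outerBoundary G S)]
  congr 3
  · ext w
    simp only [Finset.mem_filter, mem_prunedChildren h.mem_prunedSawTree, Finset.mem_erase,
      Finset.mem_sdiff, Finset.mem_compl, List.mem_toFinset, List.mem_cons]
    tauto
  · ext w
    simp only [Finset.mem_filter, mem_prunedChildren h.mem_prunedSawTree, not_not]
    constructor
    · rintro ⟨⟨h1, h2⟩, h3⟩; exact ⟨h3, h1⟩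
    · rintro ⟨h3, h1⟩
      exact ⟨⟨h1, fun h2 => notMem_outerBoundary (hS w h2) h3⟩, h3⟩

/-- A neighbour of `u` is either on the path, hence in the region, or a child, which is collected
under `hp`. -/
lemma DFSCalled.boundaryDegree_eq_zero (h : DFSCalled G v D₁ (u :: q))
    (hp : (degsum G v (u :: q) : ℝ) < D₁ ∨ ((prunedChildren G v (u :: q)).card : ℝ) < D₂) :
    boundaryDegree G (dfsRegion G v D₁ D₂) u = 0 := by
  have hS := h.mem_dfsRegion (D₂ := D₂)
  rw [boundaryDegree, if_pos (hS u List.mem_cons_self), Nat.cast_eq_zero, Finset.card_eq_zero,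
    Finset.filter_eq_empty_iff]
  intro w hw hadj
  refine notMem_outerBoundary ?_ hw
  by_cases hwq : w ∈ u :: q
  · exact hS w hwq
  · exact h.child_mem_dfsRegion hp ((mem_prunedChildren h.mem_prunedSawTree).2 ⟨hadj, hwq⟩)

end DFS

/-! ### Decay of the total influence along the search. -/

namespace TwoSpinSystem

open Classical

variable {V : Type*} [Fintype V] {M : TwoSpinSystem V} {β γ lam : ℝ}

/-- The total influence decays exponentially in the degree sum at which the search stops. -/
lemma influenceSum_le_of_dfsCalled (hM : M.IsFerromagneticWith β γ lam)
    (hr : SubcriticalRegime β γ lam) {ε Θ D₁ D₂ m' a b : ℝ} (hε : 0 < ε)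
    (hεe : ∀ b c t : ℝ, 0 < b → b ≤ β → γ ≤ c → 1 ≤ b * c → b * c ≤ β * γ → 0 ≤ t →
      edgeSlope b c (lam * Real.exp (-t)) * (t * Real.exp (ε * t)) ≤
        -Real.log (edgeFactor b c (lam * Real.exp (-t))))
    {v : V} {S : Finset V} (hS : S = dfsRegion M.graph v D₁ D₂)
    {k : V → ℝ} (hk : ∀ s, 0 ≤ k s) (hm' : 0 ≤ m') (hD₂ : 0 ≤ D₂)
    (hkΘ : ∀ s, D₂ / 3 < boundaryDegree M.graph S s → decayRate β γ lam * Θ ≤ k s)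
    (hkK : ∀ s, D₂ / 3 < boundaryDegree M.graph S s → boundaryDegree M.graph S s ≤ m' * k s)
    (hΘ₁ : Θ ≤ D₁) (hΘ₂ : Θ ≤ 2 / 3 * D₂)
    (ha : 2 * (D₂ / 3 / decayRate β γ lam) + m' ≤ a)
    (hb : a + m' + 1 / (2 * decayRate β γ lam) ≤ b)
    (n : ℕ) {u : V} {q : List V} (hq : DFSCalled M.graph v D₁ (u :: q)) {A : Finset V}
    (hA : A = (outerBoundary M.graph S)ᶜ \ q.toFinset) (hn : A.card ≤ n) :
    M.influenceSum lam k (boundaryDegree M.graph S) n A u ≤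
      b * (M.potential lam k n A u * Real.exp (ε * M.potential lam k n A u)) *
        Real.exp (-(decayRate β γ lam * ε * (Θ - degsum M.graph v q))) := by
  have hδ : 0 < decayRate β γ lam :=
    decayRate_pos hr.β_pos hr.β_le_one hr.one_lt_γ hr.lam_pos
  set δ := decayRate β γ lam
  have hl := hr.lam_pos
  have ha0 : 0 ≤ a := le_trans (by positivity) ha
  have hab : a ≤ b := by
    have : 0 < 1 / (2 * δ) := by positivity
    linarith
  have hb0 : 0 ≤ b := ha0.trans hab
  -- Below a leaf of the search, walks may continue inside the region through other copies, so the
  -- leaves need a bound for the whole remaining influence.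
  have hgeneral : ∀ n A u, M.influenceSum lam k (boundaryDegree M.graph S) n A u ≤
      boundaryDegree M.graph S u + a * M.potential lam k n A u := by
    refine fun n A u =>
      influenceSum_le hM hr hk (m := D₂ / 3) (by positivity) ha (fun s => ?_) hm' n
    have hks := mul_nonneg hm' (hk s)
    rcases le_or_gt (boundaryDegree M.graph S s) (D₂ / 3) with h | h
    · linarith
    · linarith [hkK s h]
  induction n generalizing u q A with
  | zero =>
    exfalso
    have huA : u ∈ A := by
      rw [hA, Finset.mem_sdiff, Finset.mem_compl, List.mem_toFinset]
      refine ⟨notMem_outerBoundary ?_, hq.nodup.1⟩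
      rw [hS]
      exact hq.mem_dfsRegion u List.mem_cons_self
    have := Finset.card_pos.2 ⟨u, huA⟩
    omega
  | succ n ih =>
    have huS : u ∈ S := by
      rw [hS]; exact hq.mem_dfsRegion u List.mem_cons_self
    have huA : u ∈ A := by
      rw [hA, Finset.mem_sdiff, Finset.mem_compl, List.mem_toFinset]
      exact ⟨notMem_outerBoundary huS, hq.nodup.1⟩
    have hAu : A.erase u = (outerBoundary M.graph S)ᶜ \ (u :: q).toFinset := by
      rw [hA, List.toFinset_cons]
      ext x; simp; tauto
    have hcard := hq.card_children (D₂ := D₂)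
    rw [← hS, ← hA] at hcard
    have hdeg := decayRate_mul_card_le (A := A) (v := u) hM hr hk (n := n)
    have hds : (degsum M.graph v (u :: q) : ℝ) =
        (prunedChildren M.graph v (u :: q)).card + degsum M.graph v q := by
      simp [degsum]
    have hBzero := hq.boundaryDegree_eq_zero (D₂ := D₂)
    rw [← hS] at hBzero
    have hBnn := boundaryDegree_nonneg (G := M.graph) S u
    set t := M.potential lam k (n + 1) A u with ht
    have ht0 : 0 ≤ t := potential_nonneg hM hr hk (n + 1)
    set d : ℝ := ((prunedChildren M.graph v (u :: q)).card : ℝ) with hd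
    set D : ℝ := (degsum M.graph v q : ℝ) with hD
    have hD0 : 0 ≤ D := Nat.cast_nonneg _
    -- At a leaf, a potential of at least `δ * (Θ - D)` makes `exp (ε t)` compensate the decay
    -- factor that is claimed.
    have hleaf : ∀ x : ℝ, x ≤ b * t → δ * (Θ - D) ≤ t →
        x ≤ b * (t * Real.exp (ε * t)) * Real.exp (-(δ * ε * (Θ - D))) := by
      intro x hx htD
      have : 1 ≤ Real.exp (ε * t) * Real.exp (-(δ * ε * (Θ - D))) := by
        rw [← Real.exp_add]
        apply Real.one_le_exp
        nlinarith
      calc x ≤ b * t := hx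
        _ ≤ b * t * (Real.exp (ε * t) * Real.exp (-(δ * ε * (Θ - D)))) :=
          le_mul_of_one_le_right (by positivity) this
        _ = _ := by ring
    rcases lt_or_ge (degsum M.graph v (u :: q) : ℝ) D₁ with hcall | hend
    · rw [hBzero (Or.inl hcall), add_zero] at hcard
      rw [influenceSum, hBzero (Or.inl hcall), zero_add]
      set E := Real.exp (-(δ * ε * (Θ - (d + D)))) with hE
      have hterm : ∀ w ∈ {w ∈ A.erase u | M.graph.Adj u w},
          edgeSlope (M.β s(u, w)) (M.γ s(u, w))
            (lam * Real.exp (-M.potential lam k n (A.erase u) w)) *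
            M.influenceSum lam k (boundaryDegree M.graph S) n (A.erase u) w ≤
          b * E * -Real.log (edgeFactor (M.β s(u, w)) (M.γ s(u, w))
            (lam * Real.exp (-M.potential lam k n (A.erase u) w))) := by
        intro w hw
        obtain ⟨hwA, hadj⟩ := Finset.mem_filter.1 hw
        have he : s(u, w) ∈ M.graph.edgeSet := hadj
        have hwc : w ∈ prunedChildren M.graph v (u :: q) := by
          rw [mem_prunedChildren hq.mem_prunedSawTree]
          refine ⟨hadj, fun h => ?_⟩
          rw [hAu, Finset.mem_sdiff, List.mem_toFinset] at hwA
          exact hwA.2 h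
        have hcard' : (A.erase u).card ≤ n := by
          rw [Finset.card_erase_of_mem huA]; omega
        have h1 := ih (hq.step hcall hwc) hAu hcard'
        rw [hds] at h1
        have ht' : 0 ≤ M.potential lam k n (A.erase u) w := potential_nonneg hM hr hk n
        have h2 := hεe _ _ _ (M.β_pos _ he) (hM.β_le _ he) (hM.le_γ _ he)
          (hM.one_lt_mul _ he).le (hM.mul_le _ he) ht'
        have hg0 := edgeSlope_nonneg (M.β_pos _ he) (M.γ_pos _ he) (hM.one_lt_mul _ he).le
          (x := lam * Real.exp (-M.potential lam k n (A.erase u) w)) (by positivity)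
        refine (mul_le_mul_of_nonneg_left h1 hg0).trans ?_
        rw [← hE]
        have hE0 : 0 ≤ b * E := mul_nonneg hb0 (Real.exp_pos _).le
        calc _ = b * E * (edgeSlope (M.β s(u, w)) (M.γ s(u, w))
              (lam * Real.exp (-M.potential lam k n (A.erase u) w)) *
              (M.potential lam k n (A.erase u) w *
                Real.exp (ε * M.potential lam k n (A.erase u) w))) := by ring
          _ ≤ _ := mul_le_mul_of_nonneg_left h2 hE0
      refine (Finset.sum_le_sum hterm).trans ?_
      rw [← Finset.mul_sum]
      have hsum : ∑ w ∈ A.erase u with M.graph.Adj u w,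
          -Real.log (edgeFactor (M.β s(u, w)) (M.γ s(u, w))
            (lam * Real.exp (-M.potential lam k n (A.erase u) w))) ≤ t := by
        rw [ht, potential]; linarith [hk u]
      -- The degree `d` of this node leaves the degree sum and is paid for by `δ * d ≤ t`.
      have hEe : E ≤ Real.exp (ε * t) * Real.exp (-(δ * ε * (Θ - D))) := by
        rw [hE, ← Real.exp_add]
        apply Real.exp_le_exp.2
        rw [← hcard] at hdeg
        nlinarith
      calc _ ≤ b * E * t := mul_le_mul_of_nonneg_left hsum (mul_nonneg hb0 (Real.exp_pos _).le)
        _ ≤ b * (Real.exp (ε * t) * Real.exp (-(δ * ε * (Θ - D)))) * t := by gcongr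
        _ = _ := by ring
    · have hB := hgeneral (n + 1) A u
      -- A leaf of small degree has no boundary neighbours, so all `d` children count in `t`, and `d
      -- + D ≥ D₁ ≥ Θ`. A leaf of large degree has either many boundary neighbours, where `k u` is
      -- large, or at least `2 / 3 * D₂` children off the boundary.
      rcases lt_or_ge d D₂ with hsmall | hlarge
      · rw [hBzero (Or.inr hsmall), add_zero] at hcard
        rw [hBzero (Or.inr hsmall), zero_add] at hB
        apply hleaf
        · exact hB.trans (mul_le_mul_of_nonneg_right hab ht0)
        · rw [← hcard] at hdeg
          rw [hds] at hend
          nlinarith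
      · have hkt : k u ≤ t := le_potential hM hr (n + 1)
        have hΘD : δ * (Θ - D) ≤ δ * Θ := by gcongr; linarith
        rcases lt_or_ge (D₂ / 3) (boundaryDegree M.graph S u) with h | h
        · apply hleaf _ _ (hΘD.trans ((hkΘ u h).trans hkt))
          refine hB.trans ?_
          have h1 := hkK u h
          have h2 : 0 ≤ 1 / (2 * δ) * t := by positivity
          nlinarith
        · have h1 : δ * (2 / 3 * D₂) ≤ t := by
            refine le_trans ?_ hdeg
            gcongr
            linarith
          apply hleaf _ _ (hΘD.trans (le_trans ?_ h1))
          · refine hB.trans ?_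
            have h2 : D₂ / 3 ≤ 1 / (2 * δ) * t := by
              rw [div_mul_eq_mul_div, one_mul, le_div_iff₀ (by positivity)]
              linarith
            have := mul_nonneg hm' ht0
            nlinarith
          · gcongr

end TwoSpinSystem

/-! ### Pinning the boundary: from Gibbs marginals to ratios with reduced fields. -/

/-- For `y ≤ x` the difference is at most `x * (1 - y / x)`, and `1 - r⁻¹ ≤ log r`. The factor `z`
matters: it brings in `exp (-t)` at the root. -/
lemma abs_div_one_add_sub_le {x y z : ℝ} (hx : 0 < x) (hy : 0 < y) (hxz : x ≤ z) (hyz : y ≤ z) :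
    |x / (1 + x) - y / (1 + y)| ≤ z * |Real.log x - Real.log y| := by
  wlog hyx : y ≤ x generalizing x y
  · rw [abs_sub_comm, abs_sub_comm (Real.log x)]
    exact this hy hx hyz hxz (le_of_not_ge hyx)
  have h1 : x / (1 + x) - y / (1 + y) = (x - y) / ((1 + x) * (1 + y)) := by
    field_simp; ring
  have h2 : 0 ≤ Real.log x - Real.log y := sub_nonneg.2 (Real.log_le_log hy hyx)
  rw [h1, abs_of_nonneg (div_nonneg (by linarith) (by positivity)), abs_of_nonneg h2]
  have h3 := Real.one_sub_inv_le_log_of_pos (div_pos hx hy)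
  rw [Real.log_div hx.ne' hy.ne', inv_div] at h3
  calc (x - y) / ((1 + x) * (1 + y)) ≤ x - y := by
        apply div_le_self (by linarith)
        nlinarith [mul_pos hx hy]
    _ = x * (1 - y / x) := by field_simp
    _ ≤ x * (Real.log x - Real.log y) := by gcongr
    _ ≤ _ := by gcongr

namespace TwoSpinSystem

open Classical

variable {V : Type*}

/-- The fields after pinning the vertices of `B` to `τ`. -/
noncomputable def pinnedField (M : TwoSpinSystem V) (B : Finset V) (τ : V → Fin 2) (s : V) : ℝ :=
  M.lam s * ∏ u ∈ B, if τ u = 0 then M.zeroMul u s else (M.oneMul u s)⁻¹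

lemma pinnedField_pos (M : TwoSpinSystem V) (B : Finset V) (τ : V → Fin 2) (s : V) :
    0 < M.pinnedField B τ s := by
  refine mul_pos (M.lam_pos s) (Finset.prod_pos fun u _ => ?_)
  split_ifs
  · exact M.zeroMul_pos u s
  · exact inv_pos.2 (M.oneMul_pos u s)

lemma pinnedField_insert (M : TwoSpinSystem V) {B : Finset V} (τ : V → Fin 2) {u : V} (hu : u ∉ B)
    (s : V) : M.pinnedField (insert u B) τ s =
      M.pinnedField B τ s * if τ u = 0 then M.zeroMul u s else (M.oneMul u s)⁻¹ := by
  rw [pinnedField, Finset.prod_insert hu, pinnedField]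
  ring

lemma card_subtype_filter (B : Finset V) (P : V → Prop) [DecidablePred P] :
    Finset.card {w : B | P w} = Finset.card {w ∈ B | P w} := by
  rw [← Finset.card_map (Function.Embedding.subtype (· ∈ B))]
  congr 1
  ext w
  simp only [Finset.mem_map, Finset.mem_filter, Finset.mem_univ, true_and,
    Function.Embedding.subtype_apply]
  constructor
  · rintro ⟨x, hx, rfl⟩; exact ⟨x.2, hx⟩
  · rintro ⟨h1, h2⟩; exact ⟨⟨w, h1⟩, h2, rfl⟩

section

variable {M : TwoSpinSystem V} {β γ lam : ℝ}

/-- Pinning only decreases fields, and every neighbour pinned to `1` does so by a factor `γ`. -/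
lemma pinnedField_le (hM : M.IsFerromagneticWith β γ lam) (hr : SubcriticalRegime β γ lam)
    (B : Finset V) (τ : V → Fin 2) (s : V) :
    M.pinnedField B τ s ≤ lam *
      Real.exp (-((Finset.card {w ∈ B | M.graph.Adj s w ∧ τ w = 1} : ℝ) * Real.log γ)) := by
  have hγ : 0 < γ := by linarith [hr.one_lt_γ]
  refine mul_le_mul (hM.lam_lt s).le ?_ (Finset.prod_nonneg fun u _ => ?_) hr.lam_pos.le
  · rw [Real.exp_neg, mul_comm, Real.exp_mul, Real.exp_log hγ, Real.rpow_natCast, ← inv_pow,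
      ← Finset.prod_const, Finset.prod_filter]
    refine Finset.prod_le_prod (fun u _ => ?_) fun u _ => ?_
    · split_ifs
      · exact (M.zeroMul_pos u s).le
      · exact inv_nonneg.2 (M.oneMul_pos u s).le
    · by_cases hadj : M.graph.Adj u s
      · have he : s(u, s) ∈ M.graph.edgeSet := hadj
        by_cases hτ : τ u = 0
        · simpa [hτ, zeroMul, hadj] using edge_le_one hM hr he
        · have hτ1 : τ u = 1 := by omega
          simpa [hτ1, oneMul, hadj, hadj.symm] using inv_anti₀ hγ (hM.le_γ _ he)
      · have hadj' : ¬ M.graph.Adj s u := fun h => hadj h.symm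
        simp [zeroMul, oneMul, hadj, hadj']
  · split_ifs
    · exact (M.zeroMul_pos u s).le
    · exact inv_nonneg.2 (M.oneMul_pos u s).le

lemma abs_log_pinnedField_sub_le (hM : M.IsFerromagneticWith β γ lam) {B : Finset V} {u : V}
    (hu : u ∈ B) {τ τ' : V → Fin 2} (hτ : τ u = 0) (hτ' : τ' u = 1)
    (h : ∀ w ≠ u, τ w = τ' w) (s : V) :
    |Real.log (M.pinnedField B τ s) - Real.log (M.pinnedField B τ' s)| ≤
      if M.graph.Adj s u then Real.log (β * γ) else 0 := by
  have hu' : u ∉ B.erase u := Finset.notMem_erase u B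
  have h1 : M.pinnedField (B.erase u) τ s = M.pinnedField (B.erase u) τ' s := by
    unfold pinnedField
    congr 1
    refine Finset.prod_congr rfl fun w hw => ?_
    rw [h w (Finset.ne_of_mem_erase hw)]
  rw [← Finset.insert_erase hu, M.pinnedField_insert τ hu', M.pinnedField_insert τ' hu', h1,
    if_pos hτ, if_neg (by rw [hτ']; decide),
    Real.log_mul (M.pinnedField_pos _ _ _).ne' (M.zeroMul_pos u s).ne',
    Real.log_mul (M.pinnedField_pos _ _ _).ne' (inv_pos.2 (M.oneMul_pos u s)).ne',
    add_sub_add_left_eq_sub, Real.log_inv, sub_neg_eq_add]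
  by_cases hadj : M.graph.Adj u s
  · have he : s(u, s) ∈ M.graph.edgeSet := hadj
    rw [zeroMul, oneMul, if_pos hadj, if_pos hadj, if_pos hadj.symm,
      ← Real.log_mul (M.β_pos _ he).ne' (M.γ_pos _ he).ne',
      abs_of_nonneg (Real.log_nonneg (hM.one_lt_mul _ he).le)]
    exact Real.log_le_log (by linarith [hM.one_lt_mul _ he]) (hM.mul_le _ he)
  · have hadj' : ¬ M.graph.Adj s u := fun h => hadj h.symm
    simp [zeroMul, oneMul, hadj, hadj']

end

variable [Fintype V]

lemma weight_pos (M : TwoSpinSystem V) (σ : V → Fin 2) : 0 < M.weight σ := by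
  refine mul_pos (mul_pos (Finset.prod_pos fun s _ => M.lam_pos s)
    (Finset.prod_pos fun e he => ?_)) (Finset.prod_pos fun e he => ?_)
  · exact M.β_pos e (SimpleGraph.mem_edgeFinset.1 (Finset.mem_filter.1 he).1)
  · exact M.γ_pos e (SimpleGraph.mem_edgeFinset.1 (Finset.mem_filter.1 he).1)

/-- Up to a constant, the weight of a configuration which agrees with `τ` on `B` is its weight in
the system induced on the complement of `B`, with pinned fields. -/
lemma exists_weight_eq (M : TwoSpinSystem V) (B : Finset V) (τ : V → Fin 2) :
    ∃ C : ℝ, 0 < C ∧ ∀ X : V → Fin 2, (∀ u ∈ B, X u = τ u) →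
      M.weight X = C * M.restrictedWeight Bᶜ (M.pinnedField B τ) {s ∈ Bᶜ | X s = 0} := by
  induction B using Finset.induction_on with
  | empty =>
    refine ⟨1, one_pos, fun X _ => ?_⟩
    have h1 : ∀ s, X s = 1 ↔ X s ≠ 0 := fun s => by omega
    simp [weight, restrictedWeight, pinnedField, h1]
  | insert u B hu ih =>
    obtain ⟨C, hC, h⟩ := ih
    have huB : u ∈ Bᶜ := Finset.mem_compl.2 hu
    have hB : (insert u B)ᶜ = Bᶜ.erase u := by
      ext x; simp
    have hpos : 0 < ∏ w ∈ Bᶜ.erase u, M.oneMul u w := Finset.prod_pos fun w _ => M.oneMul_pos u w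
    by_cases hτ : τ u = 0
    · refine ⟨C * M.pinnedField B τ u, mul_pos hC (M.pinnedField_pos B τ u), fun X hX => ?_⟩
      have hXu : X u = 0 := (hX u (Finset.mem_insert_self _ _)).trans hτ
      have e1 : ({s ∈ Bᶜ | X s = 0} : Finset V) = insert u {s ∈ Bᶜ.erase u | X s = 0} := by
        ext x
        by_cases hx : x = u
        · subst hx; simp [hXu, hu]
        · simp [hx]
      rw [h X fun w hw => hX w (Finset.mem_insert_of_mem hw), e1,
        M.restrictedWeight_insert (Finset.filter_subset _ _), hB,
        funext (M.pinnedField_insert τ hu)]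
      simp only [hτ, if_true]
      ring
    · refine ⟨C * ∏ w ∈ Bᶜ.erase u, M.oneMul u w, mul_pos hC hpos, fun X hX => ?_⟩
      have hXu : X u ≠ 0 := by rwa [hX u (Finset.mem_insert_self _ _)]
      have e1 : ({s ∈ Bᶜ | X s = 0} : Finset V) = {s ∈ Bᶜ.erase u | X s = 0} := by
        ext x
        by_cases hx : x = u
        · subst hx; simp [hXu]
        · simp [hx]
      rw [h X fun w hw => hX w (Finset.mem_insert_of_mem hw), e1,
        M.restrictedWeight_erase huB (Finset.filter_subset _ _), hB,
        funext (M.pinnedField_insert τ hu)]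
      simp only [hτ, if_false]
      ring

lemma sum_agreeing_eq (B : Finset V) (τ : V → Fin 2) (F : Finset V → ℝ) :
    ∑ X : V → Fin 2 with ∀ u : B, X u = τ u, F {s ∈ Bᶜ | X s = 0} =
      ∑ Y ∈ Bᶜ.powerset, F Y := by
  refine Finset.sum_bij' (fun X _ => {s ∈ Bᶜ | X s = 0})
    (fun Y _ s => if s ∈ B then τ s else if s ∈ Y then 0 else 1) ?_ ?_ ?_ ?_ ?_
  · intro X _
    exact Finset.mem_powerset.2 (Finset.filter_subset _ _)
  · intro Y _
    simp only [Finset.mem_filter, Finset.mem_univ, true_and]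
    intro u
    simp
  · intro X hX
    simp only [Finset.mem_filter, Finset.mem_univ, true_and] at hX
    ext s
    by_cases hs : s ∈ B
    · simp [hs, hX ⟨s, hs⟩]
    · by_cases h0 : X s = 0
      · simp [hs, h0]
      · have : X s = 1 := by omega
        simp [hs, this]
  · intro Y hY
    have hY := Finset.mem_powerset.1 hY
    ext s
    simp only [Finset.mem_filter, Finset.mem_compl]
    constructor
    · rintro ⟨h1, h2⟩
      by_contra h3
      simp [h1, h3] at h2
    · intro h
      have := Finset.mem_compl.1 (hY h)
      simp [this, h]
  · intros; rfl

/-- The conditional marginal at `v` in terms of the marginal ratio. -/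
lemma condMarginal_gibbs_zero (M : TwoSpinSystem V) {B : Finset V} (τ : V → Fin 2) {v : V}
    (hv : v ∉ B) : condMarginal M.gibbs B (fun u => τ u) v 0 =
      M.marginalRatio Bᶜ (M.pinnedField B τ) v / (1 + M.marginalRatio Bᶜ (M.pinnedField B τ) v) := by
  have hvB : v ∈ Bᶜ := Finset.mem_compl.2 hv
  obtain ⟨C, hC, h⟩ := M.exists_weight_eq B τ
  have hf := M.pinnedField_pos B τ
  set f := M.pinnedField B τ
  have hW : 0 < ∑ σ, M.weight σ :=
    Finset.sum_pos (fun σ _ => M.weight_pos σ) ⟨fun _ => 0, Finset.mem_univ _⟩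
  have e1 : ∑ X : V → Fin 2 with ∀ u : B, X u = τ u, M.weight X = C * M.partSum Bᶜ f := by
    rw [partSum, Finset.mul_sum, ← sum_agreeing_eq B τ]
    refine Finset.sum_congr rfl fun X hX => h X fun u hu => ?_
    exact (Finset.mem_filter.1 hX).2 ⟨u, hu⟩
  have e2 : ∑ X : V → Fin 2 with (∀ u : B, X u = τ u) ∧ X v = 0, M.weight X =
      C * M.partSumZero Bᶜ f v := by
    have e3 : M.partSumZero Bᶜ f v =
        ∑ Y ∈ Bᶜ.powerset, if v ∈ Y then M.restrictedWeight Bᶜ f Y else 0 := by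
      conv_rhs => rw [← Finset.insert_erase hvB]
      rw [Finset.sum_powerset_insert (Finset.notMem_erase v _), Finset.insert_erase hvB,
        Finset.sum_eq_zero, zero_add, partSumZero]
      · exact Finset.sum_congr rfl fun Y _ => by simp
      · intro Y hY
        rw [if_neg fun hvY => Finset.notMem_erase v _ (Finset.mem_powerset.1 hY hvY)]
    rw [e3, Finset.mul_sum, ← sum_agreeing_eq B τ, ← Finset.filter_filter, Finset.sum_filter]
    refine Finset.sum_congr rfl fun X hX => ?_
    have hX' : ∀ u ∈ B, X u = τ u := fun u hu => (Finset.mem_filter.1 hX).2 ⟨u, hu⟩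
    by_cases hXv : X v = 0
    · simp [hXv, hv, h X hX']
    · simp [hXv]
  have h0 := M.partSumZero_pos (A := Bᶜ) (v := v) hf
  have h1 := M.partSumOne_pos (A := Bᶜ) (v := v) hf
  simp only [condMarginal, gibbs]
  rw [← Finset.sum_div, ← Finset.sum_div, e1, e2, M.partSum_eq_add hvB, marginalRatio]
  field_simp
  ring

lemma condMarginal_gibbs_one (M : TwoSpinSystem V) (B : Finset V) (τ : V → Fin 2) (v : V) :
    condMarginal M.gibbs B (fun u => τ u) v 1 = 1 - condMarginal M.gibbs B (fun u => τ u) v 0 := by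
  have hgpos : ∀ σ, 0 < M.gibbs σ := fun σ =>
    div_pos (M.weight_pos σ) (Finset.sum_pos (fun σ _ => M.weight_pos σ) ⟨σ, Finset.mem_univ _⟩)
  have h1 : 0 < ∑ X : V → Fin 2 with ∀ u : B, X u = τ u, M.gibbs X :=
    Finset.sum_pos (fun X _ => hgpos X) ⟨τ, by simp⟩
  unfold condMarginal
  rw [eq_sub_iff_add_eq, ← add_div, div_eq_one_iff_eq h1.ne',
    ← Finset.sum_filter_add_sum_filter_not (s := {X : V → Fin 2 | ∀ u : B, X u = τ u})
      (p := fun X => X v = 1), Finset.filter_filter, Finset.filter_filter]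
  congr 2
  ext X
  simp only [Finset.mem_filter, Finset.mem_univ, true_and]
  have : X v = 0 ↔ ¬ X v = 1 := by omega
  rw [this]

lemma tvDist_condMarginal_eq (M : TwoSpinSystem V) {B : Finset V} (τ τ' : V → Fin 2) {v : V}
    (hv : v ∉ B) :
    tvDist (condMarginal M.gibbs B (fun u => τ u) v) (condMarginal M.gibbs B (fun u => τ' u) v) =
      |M.marginalRatio Bᶜ (M.pinnedField B τ) v / (1 + M.marginalRatio Bᶜ (M.pinnedField B τ) v) -
        M.marginalRatio Bᶜ (M.pinnedField B τ') v /
          (1 + M.marginalRatio Bᶜ (M.pinnedField B τ') v)| := by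
  rw [tvDist, Fin.sum_univ_two, condMarginal_gibbs_one, condMarginal_gibbs_one,
    sub_sub_sub_cancel_left, abs_sub_comm (condMarginal M.gibbs B (fun u => τ' u) v 0),
    add_self_div_two, M.condMarginal_gibbs_zero τ hv, M.condMarginal_gibbs_zero τ' hv]

variable {M : TwoSpinSystem V} {β γ lam : ℝ}

/-- The decay exponent of the field at `s` that good boundary conditions guarantee. -/
noncomputable def boundaryPotential (G : SimpleGraph V) (S : Finset V) (γ D₂ : ℝ) (s : V) : ℝ :=
  if D₂ / 3 < boundaryDegree G S s then
    (boundaryDegree G S s / Real.log (Fintype.card V) + 1) * Real.log γ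
  else 0

lemma boundaryPotential_nonneg (G : SimpleGraph V) (S : Finset V) (hγ : 1 < γ) (D₂ : ℝ) (s : V) :
    0 ≤ boundaryPotential G S γ D₂ s := by
  unfold boundaryPotential
  split_ifs
  · have := boundaryDegree_nonneg (G := G) S s
    have := Real.log_nonneg hγ.le
    have := Real.log_natCast_nonneg (Fintype.card V)
    positivity
  · exact le_rfl

/-- Changing the spin at `u` loses at most one neighbour of spin 1. Hence the `+ 2` in the good
boundary conditions and the `+ 1` in `boundaryPotential`. -/
lemma pinnedField_le_of_good (hM : M.IsFerromagneticWith β γ lam) (hr : SubcriticalRegime β γ lam)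
    {S : Finset V} {D₂ : ℝ} (hD₂ : 0 ≤ D₂) {σ : V → Fin 2} {u : V}
    (hσ : (fun w : outerBoundary M.graph S => σ w) ∈ goodBoundary M.graph S D₂)
    {τ : V → Fin 2} (hτ : ∀ w ≠ u, τ w = σ w) (s : V) :
    M.pinnedField (outerBoundary M.graph S) τ s ≤
      lam * Real.exp (-boundaryPotential M.graph S γ D₂ s) := by
  refine (pinnedField_le hM hr _ τ s).trans ?_
  have hl := hr.lam_pos
  have hγ := Real.log_nonneg hr.one_lt_γ.le
  gcongr
  unfold boundaryPotential
  split_ifs with hK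
  · gcongr
    by_cases hs : s ∈ S
    · rw [boundaryDegree, if_pos hs] at hK ⊢
      have h1 := hσ s hs
      dsimp only at h1
      rw [card_subtype_filter _ fun w => M.graph.Adj s w,
        card_subtype_filter _ fun w => M.graph.Adj s w ∧ σ w = 1] at h1
      have h2 := h1 hK
      have h3 : ({w ∈ outerBoundary M.graph S | M.graph.Adj s w ∧ σ w = 1} : Finset V) ⊆
          insert u {w ∈ outerBoundary M.graph S | M.graph.Adj s w ∧ τ w = 1} := by
        intro w hw
        simp only [Finset.mem_filter, Finset.mem_insert] at hw ⊢
        by_cases hwu : w = u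
        · exact Or.inl hwu
        · rw [hτ w hwu]; exact Or.inr hw
      have h4 := (Finset.card_le_card h3).trans (Finset.card_insert_le _ _)
      have h5 : (Finset.card {w ∈ outerBoundary M.graph S | M.graph.Adj s w ∧ σ w = 1} : ℝ) ≤
          Finset.card {w ∈ outerBoundary M.graph S | M.graph.Adj s w ∧ τ w = 1} + 1 := by
        exact_mod_cast h4
      linarith
    · rw [boundaryDegree, if_neg hs] at hK
      linarith
  · positivity

/-- The aggregate influence of the boundary is bounded by the total influence in the tree. -/
lemma sum_influence_le (hM : M.IsFerromagneticWith β γ lam) (hr : SubcriticalRegime β γ lam)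
    {S : Finset V} {D₂ : ℝ} (hD₂ : 0 ≤ D₂) {v : V} (hv : v ∈ S)
    (hne : (goodBoundary M.graph S D₂).Nonempty) {n : ℕ} (hn : Fintype.card V ≤ n) :
    ∑ u : outerBoundary M.graph S, influence M.gibbs (outerBoundary M.graph S)
        (goodBoundary M.graph S D₂) v u ≤
      lam * Real.exp (-M.potential lam (boundaryPotential M.graph S γ D₂) n
        (outerBoundary M.graph S)ᶜ v) * (Real.log (β * γ) *
        M.influenceSum lam (boundaryPotential M.graph S γ D₂) (boundaryDegree M.graph S) n
          (outerBoundary M.graph S)ᶜ v) := by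
  set B := outerBoundary M.graph S with hB
  set k := boundaryPotential M.graph S γ D₂ with hk
  have hk0 : ∀ s, 0 ≤ k s := boundaryPotential_nonneg M.graph S hr.one_lt_γ D₂
  have hl := hr.lam_pos
  have hvB : v ∉ B := notMem_outerBoundary hv
  set L := Real.log (β * γ)
  -- Pinning `u` also changes fields at neighbours outside `S`, but these are separated from `v` by
  -- the boundary, so they get weight 0.
  let K : B → V → ℝ := fun u s => if s ∈ S ∧ M.graph.Adj s u then L else 0
  have hinf : ∀ u : B, influence M.gibbs B (goodBoundary M.graph S D₂) v u ≤
      lam * Real.exp (-M.potential lam k n Bᶜ v) * M.influenceSum lam k (K u) n Bᶜ v := by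
    intro u
    have : Nonempty (goodBoundary M.graph S D₂) := hne.to_subtype
    refine ciSup_le fun σ => ?_
    let σ' : V → Fin 2 := fun w => if h : w ∈ B then σ.1 ⟨w, h⟩ else 0
    have hσ' : (fun w : B => σ' w) = σ.1 := by
      ext w; simp [σ']
    have hupd : ∀ c : Fin 2, Function.update σ.1 u c = fun w : B => Function.update σ' u c w := by
      intro c
      ext w
      by_cases hw : w = u
      · subst hw; simp
      · have : (w : V) ≠ u := fun h => hw (Subtype.ext h)
        simp [hw, this, ← hσ']
    have hgood : (fun w : B => σ' w) ∈ goodBoundary M.graph S D₂ := by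
      rw [hσ']; exact σ.2
    have hle : ∀ c : Fin 2, ∀ s, M.pinnedField B (Function.update σ' u c) s ≤
        lam * Real.exp (-k s) := fun c s =>
      pinnedField_le_of_good hM hr hD₂ hgood (u := u)
        (fun w hw => Function.update_of_ne hw _ _) s
    have hpos := fun c => M.pinnedField_pos B (Function.update σ' u c)
    rw [hupd, hupd, M.tvDist_condMarginal_eq _ _ hvB]
    refine (abs_div_one_add_sub_le (M.marginalRatio_pos (hpos 0)) (M.marginalRatio_pos (hpos 1))
      (marginalRatio_le hM hr (Finset.mem_compl.2 hvB) (hpos 0) (hle 0) n)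
      (marginalRatio_le hM hr (Finset.mem_compl.2 hvB) (hpos 1) (hle 1) n)).trans ?_
    gcongr
    refine abs_log_marginalRatio_sub_le hM hr hk0 (Finset.mem_compl.2 hvB) hv
      (fun s hs w hw hadj => mem_of_notMem_outerBoundary hs (Finset.mem_compl.1 hw) hadj)
      (hpos 0) (hpos 1) (hle 0) (hle 1) (fun s hs => ?_)
      ((Finset.card_le_univ _).trans (hn.trans (Nat.le_succ n)))
    refine (abs_log_pinnedField_sub_le hM u.2 (Function.update_self _ _ _)
      (Function.update_self _ _ _) (fun w hw => ?_) s).trans_eq ?_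
    · rw [Function.update_of_ne hw, Function.update_of_ne hw]
    · simp [K, hs, L]
  refine (Finset.sum_le_sum fun u _ => hinf u).trans_eq ?_
  -- By linearity the end weights add up at each `s` to `L` times its boundary degree.
  rw [← Finset.mul_sum, influenceSum_sum,
    ← influenceSum_const_mul M lam k (boundaryDegree M.graph S) L]
  refine congrArg (fun F => _ * M.influenceSum lam k F n Bᶜ v) (funext fun s => ?_)
  by_cases hs : s ∈ S
  · rw [boundaryDegree, if_pos hs, ← card_subtype_filter _ fun w => M.graph.Adj s w]
    simp only [K, hs, true_and]
    rw [← Finset.sum_filter, Finset.sum_const, nsmul_eq_mul, mul_comm]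
  · simp [K, hs, boundaryDegree]

end TwoSpinSystem

/-! ### Small graphs: the search exhausts a component. -/

section SmallGraph

open Classical

variable {V : Type*} [Fintype V] {G : SimpleGraph V} {v : V} {D₁ : ℝ}

lemma degsum_le (G : SimpleGraph V) (v : V) (p : List V) :
    degsum G v p ≤ p.length * Fintype.card V := by
  induction p with
  | nil => simp [degsum]
  | cons u p ih =>
    have := Finset.card_le_univ (prunedChildren G v (u :: p))
    rw [degsum, List.length_cons, add_mul]
    omega

/-- If the search never stops early, then the region is a connected component. -/
lemma outerBoundary_dfsRegion_eq_empty (D₂ : ℝ) (h : (Fintype.card V : ℝ) ^ 2 < D₁) :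
    outerBoundary G (dfsRegion G v D₁ D₂) = ∅ := by
  -- A self-avoiding path has at most n nodes, each with at most n children, so degree sums never
  -- exceed n².
  have hlt : ∀ p, DFSCalled G v D₁ p → (degsum G v p : ℝ) < D₁ := by
    intro p hp
    refine lt_of_le_of_lt ?_ h
    have h1 : p.length ≤ Fintype.card V := by
      cases p with
      | nil => simp
      | cons u q => exact (List.nodup_cons.2 hp.nodup).length_le_card
    have h2 := (degsum_le G v p).trans (Nat.mul_le_mul_right _ h1)
    rw [sq]
    exact_mod_cast h2
  by_contra hne
  obtain ⟨w, hw⟩ := Finset.nonempty_iff_ne_empty.2 hne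
  have hwS : w ∉ dfsRegion G v D₁ D₂ := fun h => notMem_outerBoundary h hw
  simp only [outerBoundary, Finset.mem_filter, Finset.mem_univ, true_and] at hw
  obtain ⟨-, u, hu, hadj⟩ := hw
  simp only [dfsRegion, Finset.mem_filter, Finset.mem_univ, true_and] at hu
  obtain ⟨p, hp | ⟨p', u', -, hp', hD, -⟩⟩ := hu
  · refine hwS (hp.child_mem_dfsRegion (Or.inl (hlt _ hp)) ?_)
    rw [mem_prunedChildren hp.mem_prunedSawTree]
    exact ⟨hadj, fun h => hwS (hp.mem_dfsRegion w h)⟩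
  · exact absurd (hlt _ hp') (not_lt.2 hD)

end SmallGraph

/-! ### Large graphs and the choice of constants. -/

namespace TwoSpinSystem

open Classical

variable {V : Type*} [Fintype V] {M : TwoSpinSystem V} {β γ lam : ℝ}

/-- The all-ones condition works: with `K > 9` and `log n ≥ 3` one has `K / log n + 2 ≤ K`. -/
lemma goodBoundary_nonempty (G : SimpleGraph V) (S : Finset V) {D₂ : ℝ}
    (hL : 3 ≤ Real.log (Fintype.card V)) (hD₂ : 27 ≤ D₂) : (goodBoundary G S D₂).Nonempty := by
  refine ⟨fun _ => 1, fun u _ hK => ?_⟩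
  simp only [and_true]
  set K : ℝ := (Finset.card {w : outerBoundary G S | G.Adj u w} : ℝ)
  have h1 : K / Real.log (Fintype.card V) ≤ K / 3 := by gcongr
  linarith

/-- The bound on the aggregate influence for graphs that are large compared to the constants. -/
lemma sum_influence_le_of_large (hM : M.IsFerromagneticWith β γ lam)
    (hr : SubcriticalRegime β γ lam) {ε : ℝ} (hε : 0 < ε) (hε₂ : ε ≤ 1 / 2)
    (hεe : ∀ b c t : ℝ, 0 < b → b ≤ β → γ ≤ c → 1 ≤ b * c → b * c ≤ β * γ → 0 ≤ t →
      edgeSlope b c (lam * Real.exp (-t)) * (t * Real.exp (ε * t)) ≤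
        -Real.log (edgeFactor b c (lam * Real.exp (-t))))
    {δ g L c₀ C D₁ : ℝ} (hδ : δ = decayRate β γ lam) (hg : g = Real.log γ)
    (hL : L = Real.log (Fintype.card V)) (hc₀ : c₀ = 4 / (δ * ε))
    (hC : C = 2 / (3 * δ) + 2 / g + 1 / (2 * δ)) (hL₃ : 3 ≤ L) (hL₁ : 3 * δ * c₀ / g ≤ L)
    (hL₂ : 3 / 2 * c₀ ≤ L) (hL₄ : 40 * lam * Real.log (β * γ) * C ≤ L)
    (hD₁ : c₀ * Real.log L ≤ D₁) (v : V) {S : Finset V}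
    (hS : S = dfsRegion M.graph v D₁ (L ^ 3)) :
    ∑ u : outerBoundary M.graph S, influence M.gibbs (outerBoundary M.graph S)
      (goodBoundary M.graph S (L ^ 3)) v u ≤ 1 / 20 := by
  have hδ0 : 0 < δ := by
    rw [hδ]; exact decayRate_pos hr.β_pos hr.β_le_one hr.one_lt_γ hr.lam_pos
  have hg0 : 0 < g := by rw [hg]; exact Real.log_pos hr.one_lt_γ
  have hl := hr.lam_pos
  have hL0 : 0 < L := by linarith
  have hc0 : 0 < c₀ := by rw [hc₀]; positivity
  have hlogL : Real.log L ≤ L := (Real.log_le_sub_one_of_pos hL0).trans (by linarith)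
  have hlogβγ : 0 ≤ Real.log (β * γ) := Real.log_nonneg hr.one_lt_mul.le
  have hC0 : 0 < C := by rw [hC]; positivity
  have hvS : v ∈ S := by rw [hS]; exact root_mem_dfsRegion
  have hne : (goodBoundary M.graph S (L ^ 3)).Nonempty := by
    refine goodBoundary_nonempty M.graph S (hL ▸ hL₃) ?_
    calc (27 : ℝ) = 3 ^ 3 := by norm_num
      _ ≤ L ^ 3 := by gcongr
  refine (sum_influence_le hM hr (by positivity) hvS hne le_rfl).trans ?_
  set k := boundaryPotential M.graph S γ (L ^ 3) with hk
  have hk0 : ∀ s, 0 ≤ k s := boundaryPotential_nonneg M.graph S hr.one_lt_γ _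
  have hkeq : ∀ s, L ^ 3 / 3 < boundaryDegree M.graph S s →
      k s = (boundaryDegree M.graph S s / L + 1) * g := fun s hs => by
    rw [hk, boundaryPotential, if_pos hs, hL, hg]
  set N := Fintype.card V with hN
  set B := outerBoundary M.graph S with hB
  -- The value `m' = L / g` inverts the rate at which `k` grows with the boundary degree. The
  -- constants `a` and `b` are taken minimal, so `b` is of order `L ^ 3`.
  have hU := influenceSum_le_of_dfsCalled (D₂ := L ^ 3) (Θ := c₀ * Real.log L) (m' := L / g)
    (n := N) (A := Bᶜ) hM hr hε hεe hS hk0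
    (by positivity) (by positivity) (fun s hs => ?_) (fun s hs => ?_) hD₁ ?_ le_rfl le_rfl
    DFSCalled.root (by simp [hB]) (Finset.card_le_univ _)
  · rw [← hδ] at hU
    set t := M.potential lam k N Bᶜ v with ht
    have ht0 : 0 ≤ t := potential_nonneg hM hr hk0 N
    set b := 2 * (L ^ 3 / 3 / δ) + L / g + L / g + 1 / (2 * δ) with hb
    have hbC : b ≤ C * L ^ 3 := by
      have h1 : L ≤ L ^ 3 := by nlinarith [mul_pos hL0 hL0]
      have h2 : 1 ≤ L ^ 3 := by linarith
      have h3 : L / g ≤ L ^ 3 / g := by gcongr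
      have h4 : 1 / (2 * δ) ≤ L ^ 3 / (2 * δ) := by gcongr
      have h5 : C * L ^ 3 = 2 * (L ^ 3 / 3 / δ) + L ^ 3 / g + L ^ 3 / g + L ^ 3 / (2 * δ) := by
        rw [hC]; field_simp; ring
      linarith
    -- The path above the root is empty and has degree sum 0. The 4 in `c₀ = 4 / (δ * ε)` is one
    -- more than the exponent of `L` in `b`.
    have hexp : Real.exp (-(δ * ε * (c₀ * Real.log L - (degsum M.graph v [] : ℕ)))) =
        (L ^ 4)⁻¹ := by
      have : δ * ε * (c₀ * Real.log L - (degsum M.graph v [] : ℕ)) = Real.log (L ^ 4) := by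
        rw [hc₀, Real.log_pow]
        simp only [degsum]
        push_cast
        field_simp
        ring
      rw [this, Real.exp_neg, Real.exp_log (by positivity)]
    rw [hexp] at hU
    have htexp : Real.exp (-t) * (t * Real.exp (ε * t)) ≤ 2 := by
      have h1 : Real.exp (-t) * Real.exp (ε * t) ≤ Real.exp (-(t / 2)) := by
        rw [← Real.exp_add]
        apply Real.exp_le_exp.2
        nlinarith
      have h2 : t ≤ 2 * Real.exp (t / 2) := by linarith [Real.add_one_le_exp (t / 2)]
      calc _ = t * (Real.exp (-t) * Real.exp (ε * t)) := by ring
        _ ≤ 2 * Real.exp (t / 2) * Real.exp (-(t / 2)) := by gcongr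
        _ = 2 := by rw [mul_assoc, ← Real.exp_add]; simp
    calc _ ≤ lam * Real.exp (-t) * (Real.log (β * γ) *
          (b * (t * Real.exp (ε * t)) * (L ^ 4)⁻¹)) := by gcongr
      _ = lam * Real.log (β * γ) * (L ^ 4)⁻¹ * b * (Real.exp (-t) * (t * Real.exp (ε * t))) := by
        ring
      _ ≤ lam * Real.log (β * γ) * (L ^ 4)⁻¹ * (C * L ^ 3) * 2 := by gcongr
      _ = (40 * lam * Real.log (β * γ) * C) / (20 * L) := by field_simp; ring
      _ ≤ L / (20 * L) := by gcongr
      _ = 1 / 20 := by field_simp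
  · rw [← hδ, hkeq s hs]
    rw [div_le_iff₀ hg0] at hL₁
    have h1 : L ^ 2 / 3 ≤ boundaryDegree M.graph S s / L := by
      rw [le_div_iff₀ hL0]
      nlinarith
    calc δ * (c₀ * Real.log L) ≤ δ * (c₀ * L) := by gcongr
      _ ≤ L ^ 2 / 3 * g := by nlinarith
      _ ≤ (boundaryDegree M.graph S s / L + 1) * g := by gcongr; linarith
  · rw [hkeq s hs]
    have : L / g * ((boundaryDegree M.graph S s / L + 1) * g) =
        boundaryDegree M.graph S s + L := by field_simp
    rw [this]; linarith
  · calc c₀ * Real.log L ≤ c₀ * L := by gcongr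
      _ ≤ 2 / 3 * L ^ 3 := by nlinarith [mul_pos hL0 hL0]

end TwoSpinSystem

theorem mainTheorem7 (β γ lam : ℝ) (hβ : β ≤ 1) (hγ : 1 < γ) (hβγ : 1 < β * γ)
    (hlam : 0 < lam) (hlam₀ : lam < Real.sqrt (γ / β)) :
    ∃ C₀ : ℝ, 0 < C₀ ∧ ∀ C_D : ℝ, C₀ ≤ C_D →
      ∀ (V : Type*) [Fintype V] (M : TwoSpinSystem V), M.IsFerromagneticWith β γ lam →
        3 ≤ Fintype.card V → ∀ (v : V) (D₁ D₂ : ℝ) (S : Finset V),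
          D₁ = C_D * Real.log (Real.log (Fintype.card V)) →
          D₂ = Real.log (Fintype.card V) ^ 3 →
          S = dfsRegion M.graph v D₁ D₂ →
          (goodBoundary M.graph S D₂).Nonempty ∧
            ∑ u : outerBoundary M.graph S,
              influence M.gibbs (outerBoundary M.graph S) (goodBoundary M.graph S D₂) v u ≤
                1 / 20 := by
  have hβ0 : 0 < β := by
    by_contra h
    nlinarith [mul_nonneg (sub_nonneg.2 (not_lt.1 h)) (by linarith : (0 : ℝ) ≤ γ)]
  have hr : SubcriticalRegime β γ lam := by
    refine ⟨hβ0, hβ, hγ, hβγ, hlam, ?_⟩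
    have h1 := (Real.lt_sqrt hlam.le).1 hlam₀
    rw [lt_div_iff₀ hβ0] at h1
    linarith
  obtain ⟨ε, hε, hε₂, hεe⟩ := exists_edgeSlope_mul_exp_le hβ0 hβ hγ hβγ hlam hr.mul_sq_le
  obtain ⟨δ, hδ⟩ : ∃ δ, δ = decayRate β γ lam := ⟨_, rfl⟩
  obtain ⟨g, hg⟩ : ∃ g, g = Real.log γ := ⟨_, rfl⟩
  obtain ⟨c₀, hc₀⟩ : ∃ c₀, c₀ = 4 / (δ * ε) := ⟨_, rfl⟩
  obtain ⟨C, hC⟩ : ∃ C, C = 2 / (3 * δ) + 2 / g + 1 / (2 * δ) := ⟨_, rfl⟩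
  have hδ0 : 0 < δ := by rw [hδ]; exact decayRate_pos hβ0 hβ hγ hlam
  have hc0 : 0 < c₀ := by rw [hc₀]; positivity
  -- The four thresholds serve, in order, the existence of good boundary conditions, the potential
  -- at vertices with many boundary neighbours, `Θ ≤ 2 / 3 * D₂`, and the final constant 1/20.
  set L₀ := max (max 3 (3 * δ * c₀ / g)) (max (3 / 2 * c₀) (40 * lam * Real.log (β * γ) * C))
  have hlog3 : 1 < Real.log 3 := by
    rw [Real.lt_log_iff_exp_lt (by norm_num)]
    linarith [Real.exp_one_lt_d9]
  have hll3 : 0 < Real.log (Real.log 3) := Real.log_pos hlog3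
  -- The second entry forces `D₁ > n ^ 2` whenever `log n < L₀`. It uses `log (log n) ≥ log (log 3)
  -- > 0`, which is where `n ≥ 3` enters.
  refine ⟨max c₀ ((Real.exp L₀ ^ 2 + 1) / Real.log (Real.log 3)), lt_max_of_lt_left hc0, ?_⟩
  intro C_D hC_D V _ M hM hn v D₁ D₂ S hD₁ hD₂ hS
  have hn3 : (3 : ℝ) ≤ Fintype.card V := by exact_mod_cast hn
  have hn0 : (0 : ℝ) < Fintype.card V := by linarith
  have hL3 : Real.log 3 ≤ Real.log (Fintype.card V) := Real.log_le_log (by norm_num) hn3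
  have hll : Real.log (Real.log 3) ≤ Real.log (Real.log (Fintype.card V)) :=
    Real.log_le_log (by linarith) hL3
  have hCc : c₀ ≤ C_D := (le_max_left _ _).trans hC_D
  rcases le_or_gt L₀ (Real.log (Fintype.card V)) with hlarge | hsmall
  · have h1 := (le_max_left _ _).trans hlarge
    have h2 := (le_max_right _ _).trans hlarge
    have h3 : 3 ≤ Real.log (Fintype.card V) := (le_max_left _ _).trans h1
    constructor
    · refine TwoSpinSystem.goodBoundary_nonempty M.graph S h3 ?_
      rw [hD₂]
      calc (27 : ℝ) = 3 ^ 3 := by norm_num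
        _ ≤ _ := by gcongr
    · subst hD₂
      refine TwoSpinSystem.sum_influence_le_of_large hM hr hε hε₂ hεe hδ hg rfl hc₀ hC h3
        ((le_max_right _ _).trans h1) ((le_max_left _ _).trans h2) ((le_max_right _ _).trans h2)
        ?_ v hS
      rw [hD₁]
      exact mul_le_mul_of_nonneg_right hCc (hll3.le.trans hll)
  · have hB : outerBoundary M.graph S = ∅ := by
      rw [hS]
      apply outerBoundary_dfsRegion_eq_empty
      have h1 : (Real.exp L₀ ^ 2 + 1) / Real.log (Real.log 3) ≤ C_D :=
        (le_max_right _ _).trans hC_D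
      rw [div_le_iff₀ hll3] at h1
      have h2 : (Fintype.card V : ℝ) < Real.exp L₀ := (Real.log_lt_iff_lt_exp hn0).1 hsmall
      have h3 : (Fintype.card V : ℝ) ^ 2 ≤ Real.exp L₀ ^ 2 := by gcongr
      have h4 : C_D * Real.log (Real.log 3) ≤ D₁ := by
        rw [hD₁]; gcongr
        exact hc0.le.trans hCc
      linarith
    have hempty : IsEmpty (outerBoundary M.graph S) := by rw [hB]; infer_instance
    constructor
    · refine ⟨fun _ => 1, fun u _ hK => ?_⟩
      exfalso
      have h1 : 0 ≤ D₂ := by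
        rw [hD₂]
        have : 0 < Real.log (Fintype.card V) := by linarith
        positivity
      rw [Finset.univ_eq_empty, Finset.filter_empty, Finset.card_empty, Nat.cast_zero] at hK
      linarith
    · rw [Finset.univ_eq_empty, Finset.sum_empty]
      norm_num
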